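/- **Setting.** Let $\mathcal I$ be an index set, $\ell_2=\ell_2(\mathcal I)$ (real), with norm $\|\cdot\|$. Let $A,C:\ell_2\to\ell_2$ be bounded, symmetric, positive definite, with $\gamma\|x\|^2\le\langle Ax,x\rangle\le\Gamma\|x\|^2$, $\gamma>0$. Put $\lambda(x)=\langle Ax,x\rangle/\langle Cx,x\rangle$. Assume $\underline\lambda=\min_{x\ne0}\lambda(x)>0$, $Au=\underline\lambda Cu$, $\|u\|=1$, and that for some $\Lambda>\underline\lambda$ one has $\lambda(x)\ge\Lambda$ whenever $x\neq 0$, $\langle Au,x\rangle=0$. Let $P$ be the orthogonal projection onto $\mathrm{span}\{u\}$ and $x^\perp=(I-P)x$. **Approximation spaces.** $\sigma_N(x)=\inf\{\|x-z\|:\#\mathrm{supp}\,z\le N\}$, $\|x\|_{\mathcal A^s}=\|x\|+\sup_{N}N^s\sigma_N(x)$, and $\mathcal A^s=\{x\in\ell_2:\|x\|_{\mathcal A^s}<\infty\}$. **Routines** (each with a count of its arithmetic operations, "flops"). * $B\in\{A,C\}$ is $s^*$-sparse: there is a scheme $APPLY(B,x,\delta)\to w$ ($x,w$ finitely supported, $\delta>0$)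 with $\|Bx-w\|\le\delta$ and, for every $0<s<s^*$, with constants depending only on $s$ (and the scheme): $\|w\|_{\mathcal A^s}\lesssim\|x\|_{\mathcal A^s}$, $\#\mathrm{supp}\,w\lesssim\|x\|_{\mathcal A^s}^{1/s}\delta^{-1/s}$, $\#\mathrm{flops}\lesssim\|x\|_{\mathcal A^s}^{1/s}\delta^{-1/s}+\#\mathrm{supp}\,x+1$. * $APPROX(x,\eta)\to z$, for a fixed quality factor $\omega\in[\frac12,1]$: $z$ arises from the finitely supported $x$ by replacing entries by $0$, $\|x-z\|\le\eta$, $\#\mathrm{supp}\,z\le\min\{\#\mathrm{supp}\,w:\|x-w\|\le\omega\eta\}$, with $\#\mathrm{flops}\le\kappa(\#\mathrm{supp}\,x+1)$. * $SCAL(B,x,\eta)=\langle z,w\rangle$, where $z=APPROX(x,\eta/(2\|B\|))$ and $w$ is $APPLY(B,x,\eta/2)$ restricted to $\mathrm{supp}\,z$. * $RAYL(x,\eta)=SCAL(A,x,tc_C/2)/SCAL(C,x,c_C^2t/(6\Gamma))$ with $t=\min\{\eta,\gamma/c_C,3\Gamma/c_C\}$. * $RES(x,\eta)=\alpha\big(APPLY(A,x,\tfrac{\eta}{2\alpha})-\bar\lambda\,APPLY(C,x,\tfrac{\eta}{4\bar\lambda\alpha})\big)$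 with $\bar\lambda=RAYL(x,\tfrac{\eta}{4C_C\alpha})$. **Constants.** $\theta=(1-\underline\lambda/\Lambda)\gamma$, $\alpha=2/(\theta+\Gamma)$, $\beta=(\Gamma-\theta)/(\Gamma+\theta)$, $\xi=(1+\beta)/2$, $0<a<\gamma/(2\Gamma)$, $K=\underline\lambda(1-2\Gamma a/\gamma)^{-1}$, $C_C=\Gamma/\underline\lambda$, $c_C=\gamma/K$, $\tilde c=2\alpha\Gamma C_C/\gamma$, $d=\min\{\sqrt a,\frac{1-\beta}{2\tilde cK}\}$; $M>0$ with $M\ge2\|M_\perp^{-1}\|$, where $M_\perp=(I-P)(A-\underline\lambda C)$ on $\{x:\langle x,u\rangle=0\}$; $\bar\delta=\frac12\big\{\big(1+\frac{2\gamma}{\Gamma K\|C\|M}\big)^{1/2}-1\big\}$. **MINIEIG$(A,C,\varepsilon)$.** (i) Fix $0<\varepsilon_0\le\min\{d,\bar\delta\}$, a finitely supported $x_0$ with $\|x_0\|=1$, $\|(x_0-u)^\perp\|\le\varepsilon_0$, and $0<c_1\le\min\{\frac{2}{5\varepsilon_0},(\sqrt3+\frac52)^{-1}2^{-3/2}\}$.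 Set $\bar\varepsilon=\varepsilon_0$, $\bar u=x_0$. (ii) Set $v=\bar u$, $\eta=(1-\xi)\bar\varepsilon$, $j=0$. Repeat: compute $r=RES(v,\eta)$; if $\eta+\|r\|\le\alpha c_1\bar\varepsilon/M$, go to (iii); otherwise replace $v$ by $(v-r)/\|v-r\|$, $\eta$ by $\eta/2$, $j$ by $j+1$, and if now $j\ge\log(c_1\beta)/\log\xi$, go to (iii). (iii) Set $w=APPROX(v,3c_1\bar\varepsilon/(\sqrt2\,\omega))$ and $\bar u=w/\|w\|$. If $\bar\varepsilon/2\le\min\{\varepsilon,\gamma/(4\Gamma K)\}$, stop with $u(\varepsilon)=\bar u$, $\lambda(\varepsilon)=RAYL(\bar u,\varepsilon/2)$; otherwise replace $\bar\varepsilon$ by $\bar\varepsilon/2$ and go to (ii). **Theorem.** Let $A$ and $C$ be $s^*$-sparse for some $s^*>0$. For every $\varepsilon>0$, MINIEIG$(A,C,\varepsilon)$ stops after finitely many steps with a finitely supported $u(\varepsilon)$, $\|u(\varepsilon)\|=1$, and a number $\lambda(\varepsilon)$ such that $$\|(u-u(\varepsilon))^\perp\|\le\varepsilon,\qquad|\underline\lambda-\lambda(\varepsilon)|\le\varepsilon.$$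 If moreover $u\in\mathcal A^s$ for some $0<s<s^*$ and $\#\mathrm{supp}\,x_0\le C_0\|u\|_{\mathcal A^s}^{1/s}$, then $$\#\mathrm{supp}\,u(\varepsilon),\ \#\mathrm{flops}\ \le\ C_s\max\{1,\varepsilon^{-1/s}\}\,\|u\|_{\mathcal A^s}^{1/s},\qquad\|u(\varepsilon)\|_{\mathcal A^s}\le C_s\|u\|_{\mathcal A^s},$$ where $\#\mathrm{flops}$ is the total number of operations of MINIEIG$(A,C,\varepsilon)$ after initialization, and $C_s$ depends only on $s$, on the constants in the $s^*$-sparsity estimates, on $\kappa$, $C_0$ and on $\gamma,\Gamma,\underline\lambda,\Lambda,a,\varepsilon_0,c_1,M,\omega$; in particular not on $\varepsilon$, nor on $u$ or $\mathcal I$ otherwise. (The condition on $x_0$ always holds for $C_0=\#\mathrm{supp}\,x_0$, because $\|u\|_{\mathcal A^s}\ge1$.) -/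

import Mathlib

namespace AdaptiveEigen

noncomputable section

universe v

/-! ### Sequence space, finitely supported vectors, best `N`-term approximation -/

/-- The space of square summable real sequences over the index set `I`. -/
abbrev L2 (I : Type v) : Type v := lp (fun _ : I => ℝ) 2

/-- A finitely supported sequence, regarded as an element of the sequence space. -/
def toL2 {I : Type v} (x : I →₀ ℝ) : L2 I :=
  ⟨fun i => x i, by
    refine (memℓp_zero ?_).of_exponent_ge (zero_le)
    exact x.hasFiniteSupport⟩

/-- The error of best `N`-term approximation of `x`. -/
def bestError {I : Type v} (N : ℕ) (x : L2 I) : ℝ :=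
  ⨅ z : {z : I →₀ ℝ // z.support.card ≤ N}, ‖x - toL2 z.1‖

/-- Membership in the approximation space of order `s`: `sup_N N ^ s * σ_N(x)` is finite. -/
def MemAs {I : Type v} (s : ℝ) (x : L2 I) : Prop :=
  BddAbove (Set.range fun N : ℕ => (N : ℝ) ^ s * bestError N x)

/-- The (quasi-)norm of the approximation space of order `s`; meaningful when `MemAs s x`,
in particular for all finitely supported `x`. -/
def asNorm {I : Type v} (s : ℝ) (x : L2 I) : ℝ :=
  ‖x‖ + ⨆ N : ℕ, (N : ℝ) ^ s * bestError N x

/-! ### The generalized eigenvalue problem -/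

/-- The generalized Rayleigh quotient. -/
def rayleigh {I : Type v} (A C : L2 I →L[ℝ] L2 I) (x : L2 I) : ℝ :=
  inner ℝ (A x) x / inner ℝ (C x) x

/-- `(I - P) x` with `P` the orthogonal projection onto the span of `u`. -/
def perp {I : Type v} (u x : L2 I) : L2 I :=
  x - (inner ℝ x u / inner ℝ u u) • u

/-- The real constants that enter the scheme.  `gamma`, `Gamma` are the ellipticity constants,
`lam` is the smallest eigenvalue, `Lam` the spectral gap bound, `a` fixes the angular
neighbourhood, `eps0` is the accuracy of the initial guess, `c1` and `M` enter the stopping tests,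
and `omega` is the quality factor of the thresholding routine. -/
structure Params where
  gamma : ℝ
  Gamma : ℝ
  lam : ℝ
  Lam : ℝ
  a : ℝ
  eps0 : ℝ
  c1 : ℝ
  M : ℝ
  omega : ℝ

namespace Params

variable (p : Params)

/-- Ellipticity constant of `A - lam C` on the orthogonal complement of `u`. -/
def theta : ℝ := (1 - p.lam / p.Lam) * p.gamma

/-- The relaxation parameter. -/
def alpha : ℝ := 2 / ((1 - p.lam / p.Lam) * p.gamma + p.Gamma)

/-- The contraction bound of the linear part of the iteration. -/
def beta : ℝ := (p.Gamma - p.theta) / (p.Gamma + p.theta)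

def xi : ℝ := (1 + p.beta) / 2

/-- Bound for Rayleigh quotients in the angular neighbourhood. -/
def K : ℝ := p.lam / (1 - 2 * p.Gamma * p.a / p.gamma)

/-- Bound for the norm of `C`. -/
def CC : ℝ := p.Gamma / p.lam

/-- Coercivity constant of `C` in the angular neighbourhood. -/
def cC : ℝ := p.gamma / p.K

def ctilde : ℝ := 2 * p.alpha * p.Gamma * p.CC / p.gamma

def d : ℝ := min (Real.sqrt p.a) ((1 - p.beta) / (2 * p.ctilde * p.K))

/-- The threshold below which errors are controlled by residuals; `M / 2` stands for (an upper
bound of) the norm of the inverse of `(I - P)(A - lam C)` on the orthogonal complement of `u`. -/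
def deltaBar (normC : ℝ) : ℝ :=
  (Real.sqrt (1 + p.gamma / (p.Gamma * p.K * normC * (p.M / 2))) - 1) / 2

/-- Internal target accuracy for the eigenvector. -/
def target (eps : ℝ) : ℝ := min eps (p.gamma / (4 * p.Gamma * p.K))

end Params

/-- The standing assumptions: `A`, `C` are bounded symmetric positive definite operators, `A` is
elliptic, and `p.lam` is the minimal eigenvalue, isolated and simple, with normalized
eigenvector `u`. -/
structure IsEigenProblem (p : Params) {I : Type v} (A C : L2 I →L[ℝ] L2 I) (u : L2 I) : Prop where
  gamma_pos : 0 < p.gamma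
  symm_A : ∀ x y, inner ℝ (A x) y = inner ℝ x (A y)
  symm_C : ∀ x y, inner ℝ (C x) y = inner ℝ x (C y)
  pos_C : ∀ x, x ≠ 0 → 0 < inner ℝ (C x) x
  lower_A : ∀ x, p.gamma * ‖x‖ ^ 2 ≤ inner ℝ (A x) x
  upper_A : ∀ x, inner ℝ (A x) x ≤ p.Gamma * ‖x‖ ^ 2
  norm_u : ‖u‖ = 1
  eigen : A u = p.lam • C u
  lam_pos : 0 < p.lam
  lam_min : IsLeast (rayleigh A C '' {x | x ≠ 0}) p.lam
  gap : p.lam < p.Lam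
  gap_bound : ∀ x, x ≠ 0 → inner ℝ (A u) x = 0 → p.Lam ≤ rayleigh A C x

/-- The norm of the inverse of `x ↦ (I - P)(A - lam C) x` on the orthogonal complement of `u`:
the least `m ≥ 0` with `‖x‖ ≤ m * ‖(I - P)(A - lam C) x‖` on that complement. -/
def invNorm {I : Type v} (A C : L2 I →L[ℝ] L2 I) (u : L2 I) (lam : ℝ) : ℝ :=
  sInf {m : ℝ | 0 ≤ m ∧ ∀ x : L2 I, inner ℝ x u = 0 → ‖x‖ ≤ m * ‖perp u (A x - lam • C x)‖}

/-- Admissible choices of the algorithmic parameters and of the initial guess. -/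
structure IsAdmissible (p : Params) {I : Type v} (A C : L2 I →L[ℝ] L2 I) (u : L2 I)
    (x0 : I →₀ ℝ) : Prop where
  a_pos : 0 < p.a
  a_lt : p.a < p.gamma / (2 * p.Gamma)
  M_pos : 0 < p.M
  M_ge : 2 * invNorm A C u p.lam ≤ p.M
  omega_ge : 1 / 2 ≤ p.omega
  omega_le : p.omega ≤ 1
  eps0_pos : 0 < p.eps0
  eps0_le : p.eps0 ≤ min p.d (p.deltaBar ‖C‖)
  c1_pos : 0 < p.c1
  c1_le : p.c1 ≤ min (2 / (5 * p.eps0)) ((Real.sqrt 3 + 5 / 2)⁻¹ * (2 : ℝ) ^ (-(3 / 2) : ℝ))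
  norm_x0 : ‖toL2 x0‖ = 1
  init : ‖perp u (toL2 x0 - u)‖ ≤ p.eps0

/-! ### Routines with operation counts -/

/-- The result of a computation together with the number of arithmetic operations spent. -/
structure Counted (α : Type v) where
  val : α
  flops : ℕ

/-- A scheme for the approximate application of `B` to finitely supported vectors. -/
structure ApplyScheme {I : Type v} (B : L2 I →L[ℝ] L2 I) where
  run : (I →₀ ℝ) → ℝ → Counted (I →₀ ℝ)
  accurate : ∀ x δ, 0 < δ → ‖B (toL2 x) - toL2 (run x δ).val‖ ≤ δ

/-- The scheme has the properties that make `B` an `sstar`-sparse matrix; `c s` is the constant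
in the estimates for the order `s < sstar`. -/
def ApplyScheme.IsSparse {I : Type v} {B : L2 I →L[ℝ] L2 I} (S : ApplyScheme B)
    (sstar : ℝ) (c : ℝ → ℝ) : Prop :=
  ∀ s, 0 < s → s < sstar → ∀ (x : I →₀ ℝ) (δ : ℝ), 0 < δ →
    asNorm s (toL2 (S.run x δ).val) ≤ c s * asNorm s (toL2 x) ∧
    ((S.run x δ).val.support.card : ℝ) ≤ c s * (asNorm s (toL2 x) ^ (1 / s) * δ ^ (-(1 / s))) ∧
    ((S.run x δ).flops : ℝ) ≤
      c s * (asNorm s (toL2 x) ^ (1 / s) * δ ^ (-(1 / s)) + x.support.card + 1)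

/-- A thresholding routine of quality `omega` and linear complexity: it replaces entries of `x`
by zero such that the error is at most `η`, and the output has at most as many
entries as any vector that is within `omega * η` of `x`. -/
structure ApproxRoutine (I : Type v) (omega kappa : ℝ) where
  run : (I →₀ ℝ) → ℝ → Counted (I →₀ ℝ)
  restricts : ∀ x η, 0 < η → ∀ i ∈ (run x η).val.support, (run x η).val i = x i
  accurate : ∀ x η, 0 < η → ‖toL2 x - toL2 (run x η).val‖ ≤ η
  sparse : ∀ x η, 0 < η → ∀ w : I →₀ ℝ, ‖toL2 x - toL2 w‖ ≤ omega * η →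
    (run x η).val.support.card ≤ w.support.card
  linear : ∀ x η, 0 < η → ((run x η).flops : ℝ) ≤ kappa * (x.support.card + 1)

/-- `SCAL`: approximation of `⟨B x, x⟩`.  Only the restriction of the output of the apply scheme
to the support of the thresholded vector enters the scalar product. -/
def scal {I : Type v} {omega kappa : ℝ} {B : L2 I →L[ℝ] L2 I} (S : ApplyScheme B)
    (T : ApproxRoutine I omega kappa) (x : I →₀ ℝ) (η : ℝ) : Counted ℝ :=
  let z := T.run x (η / (2 * ‖B‖))
  let w := S.run x (η / 2)
  ⟨∑ i ∈ z.val.support, z.val i * w.val i, z.flops + w.flops + 2 * z.val.support.card + 3⟩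

section Scheme

variable (p : Params) {kappa : ℝ} {I : Type v} {A C : L2 I →L[ℝ] L2 I}
  (SA : ApplyScheme A) (SC : ApplyScheme C) (T : ApproxRoutine I p.omega kappa)

/-- `RAYL`: approximation of the Rayleigh quotient of a normalized `x`. -/
def rayl (x : I →₀ ℝ) (η : ℝ) : Counted ℝ :=
  let t := min η (min (p.gamma / p.cC) (3 * p.Gamma / p.cC))
  let sA := scal SA T x (t * p.cC / 2)
  let sC := scal SC T x (p.cC ^ 2 * t / (6 * p.Gamma))
  ⟨sA.val / sC.val, sA.flops + sC.flops + 5⟩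

/-- `RES`: approximation of the scaled residual `alpha * (A - λ(x) C) x` of a normalized `x`. -/
def res (x : I →₀ ℝ) (η : ℝ) : Counted (I →₀ ℝ) :=
  let l := rayl p SA SC T x (η / (4 * p.CC * p.alpha))
  let wA := SA.run x (η / (2 * p.alpha))
  let wC := SC.run x (η / (4 * l.val * p.alpha))
  ⟨p.alpha • (wA.val - l.val • wC.val),
    l.flops + wA.flops + wC.flops + 2 * wA.val.support.card + 3 * wC.val.support.card + 8⟩

/-- Division of a finitely supported vector by its norm. -/
def normalize (x : I →₀ ℝ) : Counted (I →₀ ℝ) :=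
  ⟨‖toL2 x‖⁻¹ • x, 3 * x.support.card + 2⟩

/-- Control states of the eigensolver: inside the iteration block, before coarsening, halted. -/
inductive State (I : Type v) : Type v
  | iterate (ebar : ℝ) (w : I →₀ ℝ) (η : ℝ) (j : ℕ) : State I
  | coarsen (ebar : ℝ) (w : I →₀ ℝ) : State I
  | halted (l : ℝ) (w : I →₀ ℝ) : State I

open Classical in
/-- One step of `MINIEIG` with target accuracy `eps`, with the number of operations it takes. -/
def step (eps : ℝ) : State I → Counted (State I)
  | .iterate ebar w η j =>
    let r := res p SA SC T w η
    let cr := r.flops + 2 * r.val.support.card + 5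
    if η + ‖toL2 r.val‖ ≤ p.alpha * p.c1 * ebar / p.M then
      ⟨.coarsen ebar w, cr⟩
    else
      let n := normalize (w - r.val)
      let cn := cr + w.support.card + r.val.support.card + n.flops + 3
      if Real.log (p.c1 * p.beta) / Real.log p.xi ≤ (j + 1 : ℕ) then
        ⟨.coarsen ebar n.val, cn⟩
      else
        ⟨.iterate ebar n.val (η / 2) (j + 1), cn⟩
  | .coarsen ebar w =>
    let z := T.run w (3 * p.c1 * ebar / (Real.sqrt 2 * p.omega))
    let n := normalize z.val
    let cn := z.flops + n.flops + 6
    if ebar / 2 ≤ p.target eps then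
      let l := rayl p SA SC T n.val (eps / 2)
      ⟨.halted l.val n.val, cn + l.flops⟩
    else
      ⟨.iterate (ebar / 2) n.val ((1 - p.xi) * (ebar / 2)) 0, cn⟩
  | .halted l w => ⟨.halted l w, 0⟩

/-- The state of `MINIEIG` with target accuracy `eps` and initial guess `x0` after `n` steps, and
the total number of operations spent so far. -/
def minieig (x0 : I →₀ ℝ) (eps : ℝ) : ℕ → Counted (State I)
  | 0 => ⟨.iterate p.eps0 x0 ((1 - p.xi) * p.eps0) 0, 0⟩
  | n + 1 =>
    let q := minieig x0 eps n
    let q1 := step p SA SC T eps q.val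
    ⟨q1.val, q.flops + q1.flops⟩

end Scheme

end

end AdaptiveEigen

/-!
The eigensolver is an inexact gradient iteration `x ↦ x - α (A - λ(x) C) x` for the Rayleigh
quotient, interleaved with coarsening.

*Accuracy.* Put `S = A - lam C`. The operator `S` annihilates `u` and, by the gap, is bounded below
by `θ` on the orthogonal complement of `u`, so that `I - α S` contracts there by the factor `β`
(`norm_perp_sub_shift_le`). The Rayleigh quotient differs from `lam` by a multiple of the square of
the error (`rayleigh_sub_lam_le`), and in the angular neighbourhood this nonlinear term spoils the
contraction only a little (`norm_perp_step_le`). The residual is orthogonal to the iterate, so that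
normalization does no harm (`one_le_norm_step`). The residuals are computed with tolerances that
decay like `2 ^ (-j)`, which is faster than the errors, and therefore the error after `j`
iterations is at most `min 1 (ξ ^ j / β)` times the initial bound (`error_recursion`). A block
hence ends with an error of at most `c1` times its initial bound, either by the count of
iterations, or by the residual test (`norm_perp_le_mul_norm_residual`). Coarsening raises the error
again, but only to half of the initial bound (`isApprox_normalize_approx`).

*Complexity.* Costs are measured in units of `budget s W ε = (W / ε) ^ (1 / s)`, where `W` is the
quasi-norm of `u`; up to constants this is the number of entries that accuracy `ε` takes. A vector
within `ε` of a multiple `t u`, `|t| ≤ 1`, with at most a constant times the budget of entries has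
its quasi-norm bounded by a constant times `W` (`asNorm_toL2_le`). It is therefore enough to follow
the numbers of entries. They stay bounded in units of the budget through the boundedly many
iterations of a block (`iterate_cost`), and coarsening brings them back below a bound that does not
depend on what happened before, because a near-best approximation of `u` competes with the
thresholded vector (`card_support_approx_le`). The cost of a block is thus a fixed multiple of its
budget. As the accuracy is halved from block to block, the costs are dominated by a geometric
series, and the total is a multiple of the last budget (`pastCost_add_roundCost`).
-/

namespace AdaptiveEigen

noncomputable section

universe v

/-! ### Finitely supported sequences and best approximation -/

section Sequences

variable {I : Type v}

theorem toL2_apply (x : I →₀ ℝ) (i : I) : toL2 x i = x i := rfl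

theorem toL2_sub (x y : I →₀ ℝ) : toL2 (x - y) = toL2 x - toL2 y := by
  ext i
  simp [toL2_apply]

theorem toL2_smul (c : ℝ) (x : I →₀ ℝ) : toL2 (c • x) = c • toL2 x := by
  ext i
  simp [toL2_apply]

theorem inner_toL2 (z : I →₀ ℝ) (y : L2 I) :
    inner ℝ (toL2 z) y = ∑ i ∈ z.support, z i * y i := by
  rw [lp.inner_eq_tsum, tsum_eq_sum (s := z.support)]
  · refine Finset.sum_congr rfl fun i _ => ?_
    simp [toL2_apply, mul_comm]
  · intro i hi
    simp [toL2_apply, Finsupp.notMem_support_iff.mp hi]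

theorem norm_toL2_le_of_restricts {x z : I →₀ ℝ} (h : ∀ i ∈ z.support, z i = x i) :
    ‖toL2 z‖ ≤ ‖toL2 x‖ := by
  have h1 : inner ℝ (toL2 z) (toL2 z) = inner ℝ (toL2 z) (toL2 x) := by
    rw [inner_toL2, inner_toL2]
    exact Finset.sum_congr rfl fun i hi => by rw [toL2_apply, toL2_apply, h i hi]
  rw [real_inner_self_eq_norm_sq] at h1
  have h2 := real_inner_le_norm (toL2 z) (toL2 x)
  by_contra! hlt
  nlinarith [norm_nonneg (toL2 x)]

theorem card_support_le_of_restricts {x z : I →₀ ℝ} (h : ∀ i ∈ z.support, z i = x i) :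
    z.support.card ≤ x.support.card := by
  refine Finset.card_le_card fun i hi => ?_
  have h0 := Finsupp.mem_support_iff.mp hi
  rw [h i hi] at h0
  exact Finsupp.mem_support_iff.mpr h0

theorem card_support_smul_le (c : ℝ) (x : I →₀ ℝ) :
    (c • x).support.card ≤ x.support.card :=
  Finset.card_le_card Finsupp.support_smul

theorem card_support_sub_le (x y : I →₀ ℝ) :
    (x - y).support.card ≤ x.support.card + y.support.card := by
  classical
  exact (Finset.card_le_card Finsupp.support_sub).trans (Finset.card_union_le _ _)

theorem bestError_le {N : ℕ} (x : L2 I) {z : I →₀ ℝ} (hz : z.support.card ≤ N) :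
    bestError N x ≤ ‖x - toL2 z‖ :=
  ciInf_le (f := fun z : {z : I →₀ ℝ // z.support.card ≤ N} => ‖x - toL2 z.1‖)
    ⟨0, by rintro _ ⟨z, rfl⟩; positivity⟩ ⟨z, hz⟩

instance nonempty_card_le (N : ℕ) : Nonempty {z : I →₀ ℝ // z.support.card ≤ N} :=
  ⟨⟨0, by simp⟩⟩

theorem le_bestError {N : ℕ} {x : L2 I} {r : ℝ}
    (h : ∀ z : I →₀ ℝ, z.support.card ≤ N → r ≤ ‖x - toL2 z‖) : r ≤ bestError N x :=
  le_ciInf fun z => h z.1 z.2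

theorem bestError_nonneg (N : ℕ) (x : L2 I) : 0 ≤ bestError N x :=
  le_bestError fun _ _ => norm_nonneg _

theorem exists_norm_sub_lt_of_bestError_lt {N : ℕ} {x : L2 I} {r : ℝ} (h : bestError N x < r) :
    ∃ z : I →₀ ℝ, z.support.card ≤ N ∧ ‖x - toL2 z‖ < r := by
  obtain ⟨z, hz⟩ := exists_lt_of_ciInf_lt h
  exact ⟨z.1, z.2, hz⟩

theorem bestError_toL2_eq_zero {N : ℕ} {x : I →₀ ℝ} (h : x.support.card ≤ N) :
    bestError N (toL2 x) = 0 :=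
  le_antisymm (by simpa using bestError_le (toL2 x) h) (bestError_nonneg _ _)

theorem bestError_le_add {N : ℕ} (x y : L2 I) {t : ℝ} (ht : |t| ≤ 1) :
    bestError N x ≤ bestError N y + ‖x - t • y‖ := by
  rw [← sub_le_iff_le_add]
  refine le_bestError fun z hz => ?_
  have h1 := bestError_le x ((card_support_smul_le t z).trans hz)
  have h2 : x - toL2 (t • z) = (x - t • y) + t • (y - toL2 z) := by
    rw [toL2_smul, smul_sub]; abel
  have h3 := norm_add_le (x - t • y) (t • (y - toL2 z))
  rw [norm_smul, Real.norm_eq_abs] at h3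
  rw [h2] at h1
  nlinarith [norm_nonneg (y - toL2 z)]

theorem norm_le_asNorm (s : ℝ) (x : L2 I) : ‖x‖ ≤ asNorm s x :=
  le_add_of_nonneg_right <| Real.iSup_nonneg fun N =>
    mul_nonneg (by positivity) (bestError_nonneg N x)

theorem asNorm_nonneg (s : ℝ) (x : L2 I) : 0 ≤ asNorm s x :=
  (norm_nonneg x).trans (norm_le_asNorm s x)

theorem rpow_mul_bestError_le {s : ℝ} {x : L2 I} (h : MemAs s x) (N : ℕ) :
    (N : ℝ) ^ s * bestError N x ≤ asNorm s x :=
  (le_ciSup h N).trans (le_add_of_nonneg_left (norm_nonneg x))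

/-- A finitely supported vector that is as close to a multiple of `y` as its number of entries
permits for an element `y` of the approximation space has its quasi-norm controlled by the one of
`y`: beyond its support the best approximation errors of `x` vanish, and before that they differ
from those of `y` by at most `e`. -/
theorem asNorm_toL2_le {s D e t : ℝ} {x : I →₀ ℝ} {y : L2 I} (hs : 0 < s) (hy : MemAs s y)
    (he : 0 < e) (hD : 0 ≤ D) (ht : |t| ≤ 1) (hx : ‖toL2 x‖ ≤ asNorm s y)
    (hxy : ‖toL2 x - t • y‖ ≤ e)
    (hcard : (x.support.card : ℝ) ≤ D * (asNorm s y / e) ^ (1 / s)) :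
    asNorm s (toL2 x) ≤ (2 + D ^ s) * asNorm s y := by
  have hW := asNorm_nonneg s y
  have key : (⨆ N : ℕ, (N : ℝ) ^ s * bestError N (toL2 x)) ≤ (1 + D ^ s) * asNorm s y := by
    refine ciSup_le fun N => ?_
    rcases le_total x.support.card N with hN | hN
    · rw [bestError_toL2_eq_zero hN, mul_zero]
      positivity
    · have h1 : (N : ℝ) ^ s ≤ D ^ s * (asNorm s y / e) := by
        calc (N : ℝ) ^ s ≤ (D * (asNorm s y / e) ^ (1 / s)) ^ s :=
              Real.rpow_le_rpow (by positivity) ((Nat.cast_le.mpr hN).trans hcard) hs.le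
          _ = D ^ s * (asNorm s y / e) := by
              rw [Real.mul_rpow hD (by positivity), ← Real.rpow_mul (by positivity),
                one_div_mul_cancel hs.ne', Real.rpow_one]
      have h2 : bestError N (toL2 x) ≤ bestError N y + e :=
        (bestError_le_add _ _ ht).trans (by linarith)
      calc (N : ℝ) ^ s * bestError N (toL2 x) ≤ (N : ℝ) ^ s * (bestError N y + e) := by gcongr
        _ = (N : ℝ) ^ s * bestError N y + (N : ℝ) ^ s * e := by ring
        _ ≤ asNorm s y + D ^ s * (asNorm s y / e) * e := by
            gcongr
            exact rpow_mul_bestError_le hy N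
        _ = (1 + D ^ s) * asNorm s y := by field_simp
  unfold asNorm at hx ⊢
  unfold asNorm at key
  linarith

theorem exists_card_le_norm_sub_le {s e : ℝ} {y : L2 I} (hs : 0 < s) (hy : MemAs s y)
    (he : 0 < e) (hpos : 0 < asNorm s y) :
    ∃ z : I →₀ ℝ, (z.support.card : ℝ) ≤ (2 * asNorm s y / e) ^ (1 / s) + 1 ∧
      ‖y - toL2 z‖ ≤ e := by
  set N := ⌈(2 * asNorm s y / e) ^ (1 / s)⌉₊
  have hN : (2 * asNorm s y / e) ^ (1 / s) ≤ N := Nat.le_ceil _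
  have h1 : 2 * asNorm s y / e ≤ (N : ℝ) ^ s := by
    calc 2 * asNorm s y / e = ((2 * asNorm s y / e) ^ (1 / s)) ^ s := by
          rw [← Real.rpow_mul (by positivity), one_div_mul_cancel hs.ne', Real.rpow_one]
      _ ≤ (N : ℝ) ^ s := Real.rpow_le_rpow (by positivity) hN hs.le
  have h2 : bestError N y < e := by
    have h3 := rpow_mul_bestError_le hy N
    by_contra! hlt
    have h4 : 2 * asNorm s y ≤ (N : ℝ) ^ s * bestError N y := by
      calc 2 * asNorm s y = 2 * asNorm s y / e * e := by field_simp
        _ ≤ _ := by gcongr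
    linarith
  obtain ⟨z, hz, hze⟩ := exists_norm_sub_lt_of_bestError_lt h2
  refine ⟨z, ?_, hze.le⟩
  exact (Nat.cast_le.mpr hz).trans (Nat.ceil_lt_add_one (by positivity)).le

end Sequences

/-! ### Symmetric forms and orthogonal projection -/

/-- A symmetric operator is bounded by the bound of its quadratic form. -/
theorem norm_le_of_symmetric_of_abs_inner_le {V : Type*} [NormedAddCommGroup V]
    [InnerProductSpace ℝ V] (T : V →ₗ[ℝ] V) {b : ℝ}
    (hsymm : ∀ x y, inner ℝ (T x) y = inner ℝ x (T y))
    (hb : ∀ x, |inner ℝ (T x) x| ≤ b * ‖x‖ ^ 2) (x : V) : ‖T x‖ ≤ b * ‖x‖ := by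
  by_cases hT : T x = 0
  · rw [hT, norm_zero]
    by_cases hx : x = 0
    · simp [hx]
    · have h1 := (abs_nonneg _).trans (hb x)
      have h2 : 0 < ‖x‖ := norm_pos_iff.mpr hx
      by_contra! h3
      nlinarith
  have hTn : 0 < ‖T x‖ := norm_pos_iff.mpr hT
  have hx : 0 < ‖x‖ := norm_pos_iff.mpr fun h => hT (by rw [h, map_zero])
  have key : ∀ y, ‖y‖ = ‖x‖ → inner ℝ (T x) y ≤ b * ‖x‖ ^ 2 := by
    intro y hy
    have h1 := (abs_le.mp (hb (x + y))).2
    have h2 := (abs_le.mp (hb (x - y))).1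
    have h3 := parallelogram_law_with_norm ℝ x y
    have h4 : inner ℝ (T y) x = inner ℝ (T x) y := by
      rw [hsymm, real_inner_comm]
    simp only [map_add, map_sub, inner_add_left, inner_add_right, inner_sub_left,
      inner_sub_right, h4] at h1 h2
    rw [hy] at h3
    have h5 : b * ‖x + y‖ ^ 2 + b * ‖x - y‖ ^ 2 = 4 * (b * ‖x‖ ^ 2) := by
      linear_combination b * h3
    linarith
  have h1 := key ((‖x‖ / ‖T x‖) • T x) (by
    rw [norm_smul, Real.norm_of_nonneg (by positivity)]; field_simp)
  rw [real_inner_smul_right, real_inner_self_eq_norm_sq] at h1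
  have h2 : ‖x‖ / ‖T x‖ * ‖T x‖ ^ 2 = ‖T x‖ * ‖x‖ := by field_simp
  rw [h2] at h1
  exact le_of_mul_le_mul_right (by linarith : ‖T x‖ * ‖x‖ ≤ b * ‖x‖ * ‖x‖) hx

section Perp

variable {I : Type v} {u : L2 I}

theorem perp_add (x y : L2 I) : perp u (x + y) = perp u x + perp u y := by
  unfold perp
  rw [inner_add_left, add_div, add_smul]; abel

theorem perp_smul (c : ℝ) (x : L2 I) : perp u (c • x) = c • perp u x := by
  unfold perp
  rw [real_inner_smul_left, smul_sub, smul_smul, mul_div_assoc]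

theorem perp_sub (x y : L2 I) : perp u (x - y) = perp u x - perp u y := by
  unfold perp
  rw [inner_sub_left, sub_div, sub_smul]; abel

theorem perp_eq (hu : ‖u‖ = 1) (x : L2 I) : perp u x = x - inner ℝ x u • u := by
  unfold perp
  rw [real_inner_self_eq_norm_sq, hu]; simp

theorem perp_self (hu : ‖u‖ = 1) : perp u u = 0 := by
  rw [perp_eq hu, real_inner_self_eq_norm_sq, hu]; simp

theorem inner_perp_self (hu : ‖u‖ = 1) (x : L2 I) : inner ℝ (perp u x) u = 0 := by
  rw [perp_eq hu, inner_sub_left, real_inner_smul_left, real_inner_self_eq_norm_sq, hu]; simp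

theorem perp_eq_self_of_inner_eq_zero {x : L2 I} (h : inner ℝ x u = 0) : perp u x = x := by
  unfold perp
  simp [h]

theorem inner_perp_left (hu : ‖u‖ = 1) (x y : L2 I) :
    inner ℝ (perp u x) y = inner ℝ x (perp u y) := by
  rw [perp_eq hu, perp_eq hu, inner_sub_left, inner_sub_right, real_inner_smul_left,
    real_inner_smul_right, real_inner_comm y u, mul_comm]

theorem inner_perp_perp (hu : ‖u‖ = 1) (x y : L2 I) :
    inner ℝ (perp u x) (perp u y) = inner ℝ x (perp u y) := by
  rw [inner_perp_left hu, perp_eq_self_of_inner_eq_zero (inner_perp_self hu y)]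

theorem norm_perp_le (hu : ‖u‖ = 1) (x : L2 I) : ‖perp u x‖ ≤ ‖x‖ := by
  have h1 := inner_perp_perp hu x x
  rw [real_inner_self_eq_norm_sq] at h1
  have h2 := real_inner_le_norm x (perp u x)
  by_contra! hlt
  nlinarith [norm_nonneg x]

theorem abs_inner_le_one (hu : ‖u‖ = 1) {x : L2 I} (hx : ‖x‖ = 1) : |inner ℝ x u| ≤ 1 := by
  simpa [hu, hx] using abs_real_inner_le_norm x u

end Perp

/-! ### The constants of the scheme -/

/-- The part of the standing assumptions that speaks of the constants only. -/
structure Params.Valid (p : Params) : Prop where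
  gamma_pos : 0 < p.gamma
  gamma_le : p.gamma ≤ p.Gamma
  lam_pos : 0 < p.lam
  gap : p.lam < p.Lam
  a_pos : 0 < p.a
  a_lt : p.a < p.gamma / (2 * p.Gamma)
  M_pos : 0 < p.M
  omega_ge : 1 / 2 ≤ p.omega
  omega_le : p.omega ≤ 1
  eps0_pos : 0 < p.eps0
  eps0_le : p.eps0 ≤ p.d
  c1_pos : 0 < p.c1
  c1_le : p.c1 ≤ (Real.sqrt 3 + 5 / 2)⁻¹ * (2 : ℝ) ^ (-(3 / 2) : ℝ)

theorem IsEigenProblem.valid {p : Params} {I : Type v} {A C : L2 I →L[ℝ] L2 I} {u : L2 I}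
    {x0 : I →₀ ℝ} (h : IsEigenProblem p A C u) (ha : IsAdmissible p A C u x0) : p.Valid where
  gamma_pos := h.gamma_pos
  gamma_le := by
    have h1 := (h.lower_A u).trans (h.upper_A u)
    rwa [h.norm_u, one_pow, mul_one, mul_one] at h1
  lam_pos := h.lam_pos
  gap := h.gap
  a_pos := ha.a_pos
  a_lt := ha.a_lt
  M_pos := ha.M_pos
  omega_ge := ha.omega_ge
  omega_le := ha.omega_le
  eps0_pos := ha.eps0_pos
  eps0_le := ha.eps0_le.trans (min_le_left _ _)
  c1_pos := ha.c1_pos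
  c1_le := ha.c1_le.trans (min_le_right _ _)

namespace Params.Valid

variable {p : Params} (hp : p.Valid)
include hp

theorem Gamma_pos : 0 < p.Gamma := hp.gamma_pos.trans_le hp.gamma_le

theorem theta_pos : 0 < p.theta := by
  have h1 : p.lam / p.Lam < 1 := (div_lt_one (hp.lam_pos.trans hp.gap)).mpr hp.gap
  exact mul_pos (by linarith) hp.gamma_pos

theorem theta_lt : p.theta < p.Gamma := by
  have h1 : 0 < p.lam / p.Lam := div_pos hp.lam_pos (hp.lam_pos.trans hp.gap)
  have h2 := hp.gamma_pos
  have h3 := hp.gamma_le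
  unfold theta
  nlinarith

omit hp in
theorem alpha_eq : p.alpha = 2 / (p.theta + p.Gamma) := rfl

theorem alpha_pos : 0 < p.alpha := by
  have h1 := hp.theta_pos
  have h2 := hp.Gamma_pos
  rw [alpha_eq]; positivity

theorem alpha_mul_Gamma : p.alpha * p.Gamma = 1 + p.beta := by
  have h1 := hp.theta_pos
  have h2 := hp.Gamma_pos
  rw [alpha_eq, beta]; field_simp; ring

theorem alpha_mul_theta : p.alpha * p.theta = 1 - p.beta := by
  have h1 := hp.theta_pos
  have h2 := hp.Gamma_pos
  rw [alpha_eq, beta]; field_simp; ring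

theorem beta_pos : 0 < p.beta :=
  div_pos (by linarith [hp.theta_lt]) (by linarith [hp.theta_pos, hp.Gamma_pos])

theorem beta_lt : p.beta < 1 := by
  have h1 := mul_pos hp.alpha_pos hp.theta_pos
  rw [hp.alpha_mul_theta] at h1
  linarith

theorem xi_lt : p.xi < 1 := by
  have := hp.beta_lt
  unfold xi; linarith

theorem half_lt_xi : 1 / 2 < p.xi := by
  have := hp.beta_pos
  unfold xi; linarith

theorem K_den_pos : 0 < 1 - 2 * p.Gamma * p.a / p.gamma := by
  have h1 := hp.Gamma_pos
  have h2 := hp.a_lt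
  rw [lt_div_iff₀ (by positivity)] at h2
  rw [sub_pos, div_lt_one hp.gamma_pos]
  linarith

theorem lam_le_K : p.lam ≤ p.K := by
  have h1 := hp.K_den_pos
  have h2 : 0 < 2 * p.Gamma * p.a / p.gamma :=
    div_pos (mul_pos (mul_pos two_pos hp.Gamma_pos) hp.a_pos) hp.gamma_pos
  rw [K, le_div_iff₀ h1]
  nlinarith [hp.lam_pos]

theorem K_pos : 0 < p.K := hp.lam_pos.trans_le hp.lam_le_K

theorem cC_pos : 0 < p.cC := div_pos hp.gamma_pos hp.K_pos

theorem CC_pos : 0 < p.CC := div_pos hp.Gamma_pos hp.lam_pos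

theorem ctilde_pos : 0 < p.ctilde :=
  div_pos (mul_pos (mul_pos (mul_pos two_pos hp.alpha_pos) hp.Gamma_pos) hp.CC_pos) hp.gamma_pos

theorem le_ctilde_mul_K : 2 * (1 + p.beta) ≤ p.ctilde * p.K := by
  have h1 : 1 ≤ p.Gamma / p.gamma := (one_le_div hp.gamma_pos).mpr hp.gamma_le
  have h2 : 1 ≤ p.K / p.lam := (one_le_div hp.lam_pos).mpr hp.lam_le_K
  have h3 : p.ctilde * p.K = 2 * (p.alpha * p.Gamma) * ((p.Gamma / p.gamma) * (p.K / p.lam)) := by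
    have h4 := hp.gamma_pos.ne'
    have h5 := hp.lam_pos.ne'
    unfold ctilde CC
    field_simp
  rw [h3, hp.alpha_mul_Gamma]
  have h4 : 1 ≤ (p.Gamma / p.gamma) * (p.K / p.lam) := one_le_mul_of_one_le_of_one_le h1 h2
  have h5 := hp.beta_pos
  nlinarith

theorem mul_d_le : p.ctilde * p.K * p.d ≤ (1 - p.beta) / 2 := by
  have h0 := hp.ctilde_pos
  have h1 := hp.K_pos
  have h2 : p.d ≤ (1 - p.beta) / (2 * p.ctilde * p.K) := min_le_right _ _
  rw [le_div_iff₀ (by positivity)] at h2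
  linarith

theorem eps0_mul_le : 4 * (1 + p.beta) * p.eps0 ≤ 1 - p.beta := by
  have h1 := hp.le_ctilde_mul_K
  have h2 := hp.mul_d_le
  have h3 := hp.eps0_le
  have h4 := hp.eps0_pos
  have h5 := hp.beta_pos
  nlinarith

theorem eps0_le_quarter : p.eps0 ≤ 1 / 4 := by
  have h1 := hp.eps0_mul_le
  have h2 := hp.beta_pos
  have h3 := hp.eps0_pos
  nlinarith

theorem c1_lt : p.c1 ≤ 0.0836 := by
  refine hp.c1_le.trans ?_
  have h3 : (1.732 : ℝ) ≤ Real.sqrt 3 := Real.le_sqrt_of_sq_le (by norm_num)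
  have h2 : (1.414 : ℝ) ≤ Real.sqrt 2 := Real.le_sqrt_of_sq_le (by norm_num)
  have h4 : (2 : ℝ) ^ (-(3 / 2) : ℝ) = (2 * Real.sqrt 2)⁻¹ := by
    rw [Real.rpow_neg (by norm_num), Real.sqrt_eq_rpow,
      show (3 / 2 : ℝ) = 1 + 1 / 2 by norm_num, Real.rpow_add (by norm_num), Real.rpow_one]
  rw [h4, ← mul_inv, inv_le_comm₀ (by positivity) (by norm_num)]
  norm_num
  nlinarith

theorem target_pos {eps : ℝ} (h : 0 < eps) : 0 < p.target eps := by
  have h1 := hp.gamma_pos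
  have h2 := hp.Gamma_pos
  have h3 := hp.K_pos
  exact lt_min h (by positivity)

end Params.Valid

/-! ### The shifted operator and Rayleigh quotients -/

/-- The operator `A - l C`. -/
def shift {I : Type v} (A C : L2 I →L[ℝ] L2 I) (l : ℝ) : L2 I →L[ℝ] L2 I := A - l • C

theorem shift_apply {I : Type v} (A C : L2 I →L[ℝ] L2 I) (l : ℝ) (x : L2 I) :
    shift A C l x = A x - l • C x := rfl

namespace IsEigenProblem

variable {p : Params} {I : Type v} {A C : L2 I →L[ℝ] L2 I} {u : L2 I}
  (h : IsEigenProblem p A C u)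
include h

theorem lam_mul_inner_le (x : L2 I) : p.lam * inner ℝ (C x) x ≤ inner ℝ (A x) x := by
  by_cases hx : x = 0
  · simp [hx]
  · have h1 : p.lam ≤ rayleigh A C x := h.lam_min.2 ⟨x, hx, rfl⟩
    rwa [rayleigh, le_div_iff₀ (h.pos_C x hx)] at h1

theorem inner_C_nonneg (x : L2 I) : 0 ≤ inner ℝ (C x) x := by
  by_cases hx : x = 0
  · simp [hx]
  · exact (h.pos_C x hx).le

theorem norm_A_pos : 0 < ‖A‖ := by
  rw [norm_pos_iff]
  rintro rfl
  have h1 := h.lower_A u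
  rw [h.norm_u] at h1
  simp at h1
  linarith [h.gamma_pos]

theorem norm_C_pos : 0 < ‖C‖ := by
  rw [norm_pos_iff]
  rintro rfl
  simpa using h.pos_C u fun h0 => by simpa [h0] using h.norm_u

theorem inner_C_le (x : L2 I) : inner ℝ (C x) x ≤ p.CC * ‖x‖ ^ 2 := by
  have h1 := (h.lam_mul_inner_le x).trans (h.upper_A x)
  rw [Params.CC, div_mul_eq_mul_div, le_div_iff₀ h.lam_pos]
  linarith

theorem norm_C_apply_le (x : L2 I) : ‖C x‖ ≤ p.CC * ‖x‖ :=
  norm_le_of_symmetric_of_abs_inner_le C.toLinearMap h.symm_C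
    (fun y => by
      simpa [abs_of_nonneg (h.inner_C_nonneg y)] using h.inner_C_le y) x

theorem inner_shift_comm (l : ℝ) (x y : L2 I) :
    inner ℝ (shift A C l x) y = inner ℝ x (shift A C l y) := by
  simp only [shift_apply, inner_sub_left, inner_sub_right, real_inner_smul_left,
    real_inner_smul_right, h.symm_A x y, h.symm_C x y]

theorem shift_u : shift A C p.lam u = 0 := by
  rw [shift_apply, h.eigen, sub_self]

theorem shift_sub_smul (x : L2 I) (t : ℝ) :
    shift A C p.lam (x - t • u) = shift A C p.lam x := by
  rw [map_sub, map_smul, h.shift_u, smul_zero, sub_zero]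

theorem inner_shift_sub_smul (x : L2 I) (t : ℝ) :
    inner ℝ (shift A C p.lam (x - t • u)) (x - t • u) = inner ℝ (shift A C p.lam x) x := by
  rw [h.shift_sub_smul, inner_sub_right, h.inner_shift_comm, real_inner_smul_right,
    h.inner_shift_comm _ x u, h.shift_u, inner_zero_right, mul_zero, sub_zero]

theorem shift_perp (x : L2 I) : shift A C p.lam (perp u x) = shift A C p.lam x := by
  rw [perp_eq h.norm_u, h.shift_sub_smul]

theorem inner_shift_perp (x : L2 I) :
    inner ℝ (shift A C p.lam (perp u x)) (perp u x) = inner ℝ (shift A C p.lam x) x := by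
  rw [perp_eq h.norm_u, h.inner_shift_sub_smul]

theorem inner_shift_le (x : L2 I) :
    inner ℝ (shift A C p.lam x) x ≤ p.Gamma * ‖x‖ ^ 2 := by
  rw [shift_apply, inner_sub_left, real_inner_smul_left]
  nlinarith [h.upper_A x, h.lam_pos, h.inner_C_nonneg x]

/-- On the orthogonal complement of the eigenvector the shifted operator is coercive.  The gap
assumption speaks of vectors that are orthogonal to `u` in the `A`-inner product; subtracting a
multiple of `u` passes to such a vector, changes neither the quadratic form nor the orthogonal
projection, and does not decrease the norm. -/
theorem theta_mul_le (hp : p.Valid) {y : L2 I} (hy : inner ℝ y u = 0) :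
    p.theta * ‖y‖ ^ 2 ≤ inner ℝ (shift A C p.lam y) y := by
  have hAu : 0 < inner ℝ (A u) u := by
    have h1 := h.lower_A u
    rw [h.norm_u, one_pow, mul_one] at h1
    exact hp.gamma_pos.trans_le h1
  set t := inner ℝ (A u) y / inner ℝ (A u) u with ht
  set z := y - t • u with hz
  have hzA : inner ℝ (A u) z = 0 := by
    rw [hz, inner_sub_right, real_inner_smul_right, ht, div_mul_cancel₀ _ hAu.ne', sub_self]
  have hzy : ‖y‖ ≤ ‖z‖ := by
    have h1 : perp u z = y := by
      rw [hz, perp_sub, perp_smul, perp_self h.norm_u, smul_zero, sub_zero,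
        perp_eq_self_of_inner_eq_zero hy]
    rw [← h1]
    exact norm_perp_le h.norm_u z
  have hq : p.Lam * inner ℝ (C z) z ≤ inner ℝ (A z) z := by
    by_cases hz0 : z = 0
    · simp [hz0]
    · have h1 := h.gap_bound z hz0 hzA
      rwa [rayleigh, le_div_iff₀ (h.pos_C z hz0)] at h1
  rw [← h.inner_shift_sub_smul y t, ← hz, shift_apply, inner_sub_left, real_inner_smul_left]
  have hL : 0 < p.Lam := hp.lam_pos.trans hp.gap
  have h1 : p.lam * inner ℝ (C z) z ≤ p.lam / p.Lam * inner ℝ (A z) z := by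
    have h2 := mul_le_mul_of_nonneg_left hq (div_pos hp.lam_pos hL).le
    rwa [← mul_assoc, div_mul_cancel₀ _ hL.ne'] at h2
  have h2 := h.lower_A z
  have h3 : 0 < 1 - p.lam / p.Lam := by
    rw [sub_pos, div_lt_one hL]; exact hp.gap
  calc p.theta * ‖y‖ ^ 2 ≤ p.theta * ‖z‖ ^ 2 := by
        have := hp.theta_pos
        gcongr
    _ = (1 - p.lam / p.Lam) * (p.gamma * ‖z‖ ^ 2) := by rw [Params.theta]; ring
    _ ≤ (1 - p.lam / p.Lam) * inner ℝ (A z) z := by gcongr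
    _ ≤ _ := by linarith

/-- The linear part of the iteration contracts on the orthogonal complement of the
eigenvector. -/
theorem norm_perp_sub_shift_le (hp : p.Valid) (y : L2 I) :
    ‖perp u (y - p.alpha • shift A C p.lam y)‖ ≤ p.beta * ‖perp u y‖ := by
  let T : L2 I →ₗ[ℝ] L2 I :=
    { toFun := fun x => perp u (x - p.alpha • shift A C p.lam x)
      map_add' := fun x y => by rw [map_add, smul_add, add_sub_add_comm, perp_add]
      map_smul' := fun c x => by
        rw [map_smul, smul_comm, ← smul_sub, perp_smul, RingHom.id_apply] }
  have hT : ∀ x, T x = perp u x - p.alpha • perp u (shift A C p.lam x) := fun x => by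
    show perp u _ = _
    rw [perp_sub, perp_smul]
  have hTp : ∀ x, T (perp u x) = T x := fun x => by
    rw [hT, hT, h.shift_perp, perp_eq_self_of_inner_eq_zero (inner_perp_self h.norm_u x)]
  have hin : ∀ x y, inner ℝ (T x) y =
      inner ℝ (perp u x) (perp u y) -
        p.alpha * inner ℝ (shift A C p.lam (perp u x)) (perp u y) := by
    intro x y
    rw [hT, inner_sub_left, real_inner_smul_left, h.shift_perp, inner_perp_left h.norm_u _ y,
      inner_perp_perp h.norm_u, inner_perp_left h.norm_u _ y]
  have key := norm_le_of_symmetric_of_abs_inner_le T (b := p.beta) ?_ ?_ (perp u y)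
  · rwa [hTp] at key
  · intro x y
    rw [real_inner_comm (T y) x, hin, hin, h.inner_shift_comm, real_inner_comm (perp u y),
      real_inner_comm (perp u x) (shift A C p.lam (perp u y))]
  · intro x
    rw [hin, real_inner_self_eq_norm_sq]
    have h1 := h.theta_mul_le hp (inner_perp_self h.norm_u x)
    have h2 := h.inner_shift_le (perp u x)
    have h3 : ‖perp u x‖ ^ 2 ≤ ‖x‖ ^ 2 := by
      gcongr
      exact norm_perp_le h.norm_u x
    have h4 := mul_le_mul_of_nonneg_left h1 hp.alpha_pos.le
    have h5 := mul_le_mul_of_nonneg_left h2 hp.alpha_pos.le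
    rw [← mul_assoc, hp.alpha_mul_theta] at h4
    rw [← mul_assoc, hp.alpha_mul_Gamma] at h5
    have h6 := mul_le_mul_of_nonneg_left h3 hp.beta_pos.le
    rw [abs_le]
    constructor <;> linarith

section Angular

variable (hp : p.Valid) {x : L2 I} (hx : ‖x‖ = 1) (hd : ‖perp u x‖ ≤ p.d)
include hp hx

omit hp in
theorem gamma_le_inner_A : p.gamma ≤ inner ℝ (A x) x := by
  simpa [hx] using h.lower_A x

omit hp in
theorem inner_A_le : inner ℝ (A x) x ≤ p.Gamma := by
  simpa [hx] using h.upper_A x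

omit hp in
theorem inner_C_pos : 0 < inner ℝ (C x) x :=
  h.pos_C x fun h0 => by simp [h0] at hx

omit hp in
theorem rayleigh_sub_lam_mul :
    (rayleigh A C x - p.lam) * inner ℝ (C x) x = inner ℝ (shift A C p.lam x) x := by
  rw [rayleigh, sub_mul, div_mul_cancel₀ _ (h.inner_C_pos hx).ne', shift_apply, inner_sub_left,
    real_inner_smul_left]

omit hp in
theorem lam_le_rayleigh : p.lam ≤ rayleigh A C x :=
  h.lam_min.2 ⟨x, fun h0 => by simp [h0] at hx, rfl⟩

include hd

theorem inner_A_le_K_mul : inner ℝ (A x) x ≤ p.K * inner ℝ (C x) x := by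
  have h0 : ‖perp u x‖ ^ 2 ≤ p.a := by
    have h1 : ‖perp u x‖ ≤ Real.sqrt p.a := hd.trans (min_le_left _ _)
    rwa [Real.le_sqrt (norm_nonneg _) hp.a_pos.le] at h1
  have h1 := h.inner_shift_le (perp u x)
  rw [h.inner_shift_perp, shift_apply, inner_sub_left, real_inner_smul_left] at h1
  have h2 : p.Gamma * ‖perp u x‖ ^ 2 ≤ 2 * p.Gamma * p.a := by
    have h3 := hp.Gamma_pos
    have h4 := hp.a_pos
    nlinarith
  have h3 : 2 * p.Gamma * p.a ≤ 2 * p.Gamma * p.a / p.gamma * inner ℝ (A x) x := by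
    have h4 := h.gamma_le_inner_A hx
    have h5 := hp.Gamma_pos
    have h6 := hp.a_pos
    rw [div_mul_eq_mul_div, le_div_iff₀ hp.gamma_pos]
    gcongr
  rw [Params.K, div_mul_eq_mul_div, le_div_iff₀ hp.K_den_pos]
  linarith

theorem cC_le_inner_C : p.cC ≤ inner ℝ (C x) x := by
  rw [Params.cC, div_le_iff₀' hp.K_pos]
  exact (h.gamma_le_inner_A hx).trans (h.inner_A_le_K_mul hp hx hd)

theorem rayleigh_le_K : rayleigh A C x ≤ p.K := by
  rw [rayleigh, div_le_iff₀ (h.inner_C_pos hx)]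
  exact h.inner_A_le_K_mul hp hx hd

/-- The eigenvalue error is quadratic in the eigenvector error. -/
theorem rayleigh_sub_lam_le :
    rayleigh A C x - p.lam ≤ p.Gamma * p.K / p.gamma * ‖perp u x‖ ^ 2 := by
  have h1 := h.rayleigh_sub_lam_mul hx
  rw [← h.inner_shift_perp] at h1
  have h2 := h.inner_shift_le (perp u x)
  have h3 := h.cC_le_inner_C hp hx hd
  have h4 := h.lam_le_rayleigh hx
  have h5 : (rayleigh A C x - p.lam) * p.cC ≤ p.Gamma * ‖perp u x‖ ^ 2 := by
    have := mul_le_mul_of_nonneg_left h3 (sub_nonneg.mpr h4)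
    linarith
  have h6 := hp.gamma_pos
  have h7 := hp.K_pos
  rw [← le_div_iff₀ hp.cC_pos] at h5
  refine h5.trans_eq ?_
  rw [Params.cC]; field_simp

/-- The exact iteration reduces the eigenvector error up to normalization; the nonlinear
perturbation of the Rayleigh quotient is absorbed by the size of the angular neighbourhood. -/
theorem norm_perp_step_le :
    ‖perp u (x - p.alpha • shift A C (rayleigh A C x) x)‖ ≤
      (1 + 3 * p.beta) / 4 * ‖perp u x‖ := by
  have h1 : x - p.alpha • shift A C (rayleigh A C x) x =
      (x - p.alpha • shift A C p.lam x) + (p.alpha * (rayleigh A C x - p.lam)) • C x := by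
    simp only [shift_apply]
    module
  have h2 := h.norm_perp_sub_shift_le hp x
  have h3 : ‖perp u ((p.alpha * (rayleigh A C x - p.lam)) • C x)‖ ≤
      p.alpha * (rayleigh A C x - p.lam) * p.CC := by
    have h4 := sub_nonneg.mpr (h.lam_le_rayleigh hx)
    have h5 := hp.alpha_pos
    rw [perp_smul, norm_smul, Real.norm_of_nonneg (by positivity)]
    gcongr
    refine (norm_perp_le h.norm_u _).trans ((h.norm_C_apply_le x).trans_eq ?_)
    rw [hx, mul_one]
  have h4 := h.rayleigh_sub_lam_le hp hx hd
  have h5 : p.alpha * (rayleigh A C x - p.lam) * p.CC ≤ (1 - p.beta) / 4 * ‖perp u x‖ := by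
    have e0 := hp.alpha_pos
    have e1 := hp.CC_pos
    have e2 := hp.ctilde_pos
    have e3 := hp.K_pos
    have e4 := hp.mul_d_le
    calc p.alpha * (rayleigh A C x - p.lam) * p.CC
        ≤ p.alpha * (p.Gamma * p.K / p.gamma * ‖perp u x‖ ^ 2) * p.CC := by gcongr
      _ = p.ctilde * p.K / 2 * ‖perp u x‖ * ‖perp u x‖ := by rw [Params.ctilde]; ring
      _ ≤ p.ctilde * p.K / 2 * p.d * ‖perp u x‖ := by gcongr
      _ ≤ (1 - p.beta) / 4 * ‖perp u x‖ := by
          refine mul_le_mul_of_nonneg_right ?_ (norm_nonneg _)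
          linarith
  rw [h1, perp_add]
  refine (norm_add_le _ _).trans ?_
  linarith

omit hd hp in
/-- The residual is orthogonal to the iterate, so that the iteration does not decrease norms. -/
theorem one_le_norm_step (t : ℝ) : 1 ≤ ‖x - t • shift A C (rayleigh A C x) x‖ := by
  have h1 : inner ℝ (shift A C (rayleigh A C x) x) x = 0 := by
    rw [shift_apply, inner_sub_left, real_inner_smul_left, rayleigh,
      div_mul_cancel₀ _ (h.inner_C_pos hx).ne', sub_self]
  have h2 := norm_sub_sq_real x (t • shift A C (rayleigh A C x) x)
  rw [real_inner_smul_right, real_inner_comm, h1, hx] at h2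
  nlinarith [norm_nonneg (x - t • shift A C (rayleigh A C x) x),
    sq_nonneg ‖t • shift A C (rayleigh A C x) x‖]

end Angular

/-- The infimum in the definition of `invNorm` is approached, so that every larger number is a
bound for the inverse. -/
theorem norm_le_mul_of_invNorm_le (hp : p.Valid) {m : ℝ} (hm : invNorm A C u p.lam ≤ m)
    {y : L2 I} (hy : inner ℝ y u = 0) : ‖y‖ ≤ m * ‖perp u (shift A C p.lam y)‖ := by
  have hne : {m : ℝ | 0 ≤ m ∧ ∀ x : L2 I, inner ℝ x u = 0 →
      ‖x‖ ≤ m * ‖perp u (A x - p.lam • C x)‖}.Nonempty := by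
    have hθ := hp.theta_pos
    refine ⟨p.theta⁻¹, by positivity, fun x hx => ?_⟩
    rw [inv_mul_eq_div, le_div_iff₀ hθ]
    have h1 := h.theta_mul_le hp hx
    have h2 : inner ℝ (shift A C p.lam x) x ≤ ‖perp u (shift A C p.lam x)‖ * ‖x‖ := by
      have h3 := real_inner_le_norm (perp u (shift A C p.lam x)) x
      rwa [inner_perp_left h.norm_u, perp_eq_self_of_inner_eq_zero hx] at h3
    rw [shift_apply] at h2
    rcases (norm_nonneg x).eq_or_lt with h0 | h0
    · rw [← h0, zero_mul]; positivity
    · refine le_of_mul_le_mul_right ?_ h0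
      rw [shift_apply] at h1
      linarith
  refine le_of_forall_pos_le_add fun δ hδ => ?_
  set n := ‖perp u (shift A C p.lam y)‖ with hn
  have hn0 : 0 ≤ n := norm_nonneg _
  obtain ⟨m', ⟨_, hm'⟩, hlt⟩ := exists_lt_of_csInf_lt hne
    (show _ < m + δ / (n + 1) from lt_of_le_of_lt hm (lt_add_of_pos_right _ (by positivity)))
  refine (hm' y hy).trans ?_
  rw [← shift_apply, ← hn]
  have h1 : δ / (n + 1) * n ≤ δ := by
    rw [div_mul_eq_mul_div, div_le_iff₀ (by positivity)]
    nlinarith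
  nlinarith

/-- Close to the eigenvector the error is controlled by the residual. -/
theorem norm_perp_le_mul_norm_residual (hp : p.Valid) (hM : 2 * invNorm A C u p.lam ≤ p.M)
    {x : L2 I} (hx : ‖x‖ = 1) (hd : ‖perp u x‖ ≤ p.d) (hδ : ‖perp u x‖ ≤ p.deltaBar ‖C‖) :
    ‖perp u x‖ ≤ p.M * ‖shift A C (rayleigh A C x) x‖ := by
  set e := ‖perp u x‖ with he
  have he0 : 0 ≤ e := norm_nonneg _
  set g := shift A C (rayleigh A C x) x with hg
  have hM0 := hp.M_pos
  have hCn := h.norm_C_pos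
  set q := p.Gamma * p.K / p.gamma with hq
  have hq0 : 0 < q := div_pos (mul_pos hp.Gamma_pos hp.K_pos) hp.gamma_pos
  have h1 : shift A C p.lam x = g + (rayleigh A C x - p.lam) • C x := by
    rw [hg]; simp only [shift_apply]; module
  have h2 : ‖perp u (shift A C p.lam x)‖ ≤ ‖g‖ + q * e ^ 2 * ‖C‖ := by
    refine (norm_perp_le h.norm_u _).trans ?_
    rw [h1]
    refine (norm_add_le _ _).trans ?_
    have h3 := sub_nonneg.mpr (h.lam_le_rayleigh hx)
    rw [norm_smul, Real.norm_of_nonneg h3]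
    gcongr
    · exact h.rayleigh_sub_lam_le hp hx hd
    · simpa [hx] using C.le_opNorm x
  have h3 : e ≤ p.M / 2 * (‖g‖ + q * e ^ 2 * ‖C‖) := by
    have h4 := h.norm_le_mul_of_invNorm_le hp (m := p.M / 2) (by linarith)
      (inner_perp_self h.norm_u x)
    rw [h.shift_perp] at h4
    refine h4.trans ?_
    gcongr
  -- the threshold solves `δ + δ ^ 2 = 1 / (2 * q * ‖C‖ * M)`
  have h4 : p.M * q * ‖C‖ * e ≤ 1 / 2 := by
    have h5 : p.gamma / (p.Gamma * p.K * ‖C‖ * (p.M / 2)) = 2 / (q * ‖C‖ * p.M) := by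
      have := hp.gamma_pos
      have := hp.Gamma_pos
      have := hp.K_pos
      rw [hq]; field_simp
    have h6 : 2 * e + 1 ≤ Real.sqrt (1 + 2 / (q * ‖C‖ * p.M)) := by
      rw [Params.deltaBar, h5] at hδ
      linarith
    rw [Real.le_sqrt (by positivity) (by positivity)] at h6
    have h7 : 4 * e ≤ 2 / (q * ‖C‖ * p.M) := by nlinarith
    rw [le_div_iff₀ (by positivity)] at h7
    linarith
  have h5 : p.M * q * ‖C‖ * e * e ≤ 1 / 2 * e := mul_le_mul_of_nonneg_right h4 he0
  have h6 := mul_nonneg hM0.le (norm_nonneg g)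
  nlinarith

end IsEigenProblem

/-! ### Accuracy of the routines -/

/-- A normalized finitely supported vector whose component orthogonal to `u` has norm at most
`e`. -/
def IsApprox {I : Type v} (u : L2 I) (e : ℝ) (x : I →₀ ℝ) : Prop :=
  ‖toL2 x‖ = 1 ∧ ‖perp u (toL2 x)‖ ≤ e

theorem IsApprox.mono {I : Type v} {u : L2 I} {e e' : ℝ} {x : I →₀ ℝ} (h : IsApprox u e x)
    (he : e ≤ e') : IsApprox u e' x := ⟨h.1, h.2.trans he⟩

theorem norm_toL2_normalize {I : Type v} {x : I →₀ ℝ} (hx : 0 < ‖toL2 x‖) :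
    ‖toL2 (normalize x).val‖ = 1 := by
  rw [normalize, toL2_smul, norm_smul, norm_inv, norm_norm, inv_mul_cancel₀ hx.ne']

theorem norm_perp_normalize {I : Type v} (u : L2 I) (x : I →₀ ℝ) :
    ‖perp u (toL2 (normalize x).val)‖ = ‖perp u (toL2 x)‖ / ‖toL2 x‖ := by
  rw [normalize, toL2_smul, perp_smul, norm_smul, norm_inv, norm_norm, inv_mul_eq_div]

theorem card_support_normalize_le {I : Type v} (x : I →₀ ℝ) :
    (normalize x).val.support.card ≤ x.support.card :=
  card_support_smul_le _ _

theorem abs_scal_sub_inner_le {I : Type v} {omega kappa : ℝ} {B : L2 I →L[ℝ] L2 I}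
    (S : ApplyScheme B) (T : ApproxRoutine I omega kappa) {x : I →₀ ℝ} {η : ℝ} (hη : 0 < η)
    (hB : 0 < ‖B‖) (hx : ‖toL2 x‖ = 1) :
    |(scal S T x η).val - inner ℝ (B (toL2 x)) (toL2 x)| ≤ η := by
  set z := (T.run x (η / (2 * ‖B‖))).val
  set w := (S.run x (η / 2)).val
  have hη' : 0 < η / (2 * ‖B‖) := by positivity
  have h1 : (scal S T x η).val = inner ℝ (toL2 z) (toL2 w) := (inner_toL2 z (toL2 w)).symm
  have hz : ‖toL2 z‖ ≤ 1 := (norm_toL2_le_of_restricts (T.restricts x _ hη')).trans hx.le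
  have e1 : |inner ℝ (toL2 z) (B (toL2 x) - toL2 w)| ≤ η / 2 := by
    have h2 := S.accurate x (η / 2) (by positivity)
    refine (abs_real_inner_le_norm _ _).trans ?_
    nlinarith [norm_nonneg (B (toL2 x) - toL2 w)]
  have e2 : |inner ℝ (toL2 x - toL2 z) (B (toL2 x))| ≤ η / 2 := by
    have h2 := T.accurate x _ hη'
    have h3 : ‖B (toL2 x)‖ ≤ ‖B‖ := by simpa [hx] using B.le_opNorm (toL2 x)
    refine (abs_real_inner_le_norm _ _).trans ?_
    calc ‖toL2 x - toL2 z‖ * ‖B (toL2 x)‖ ≤ η / (2 * ‖B‖) * ‖B‖ := by gcongr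
      _ = η / 2 := by field_simp
  have h2 : inner ℝ (toL2 z) (toL2 w) - inner ℝ (B (toL2 x)) (toL2 x) =
      -(inner ℝ (toL2 z) (B (toL2 x) - toL2 w) + inner ℝ (toL2 x - toL2 z) (B (toL2 x))) := by
    rw [inner_sub_right, inner_sub_left, real_inner_comm (toL2 x) (B (toL2 x))]; ring
  rw [h1, h2, abs_neg]
  exact (abs_add_le _ _).trans (by linarith)

/-- Propagation of the errors of numerator and denominator to a quotient. -/
theorem abs_div_sub_div_le {γ Γ c t a a' b b' : ℝ} (hγ : 0 < γ) (hc : 0 < c)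
    (ht : 0 < t) (htγ : t ≤ γ / c) (htΓ : t ≤ 3 * Γ / c) (ha : γ ≤ a) (haΓ : a ≤ Γ) (hb : c ≤ b)
    (ha' : |a' - a| ≤ t * c / 2) (hb' : |b' - b| ≤ c ^ 2 * t / (6 * Γ)) :
    0 < a' ∧ 0 < b' ∧ |a' / b' - a / b| ≤ t := by
  have hΓ : 0 < Γ := by linarith
  rw [le_div_iff₀ hc] at htγ htΓ
  have ha1 := abs_le.mp ha'
  have hb1 := abs_le.mp hb'
  have h1 : c ^ 2 * t / (6 * Γ) ≤ c / 2 := by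
    rw [div_le_iff₀ (by positivity)]
    nlinarith
  have hb0 : 0 < b := hc.trans_le hb
  have hb2 : c / 2 ≤ b' := by linarith
  have hb3 : 0 < b' := by linarith
  have ha2 : 0 < a' := by linarith
  refine ⟨ha2, hb3, ?_⟩
  have h2 : a' / b' - a / b = (a' - a) / b - a' * (b' - b) / (b * b') := by
    field_simp; ring
  have e1 : |(a' - a) / b| ≤ t / 2 := by
    rw [abs_div, abs_of_pos hb0, div_le_iff₀ hb0]
    nlinarith
  have e2 : |a' * (b' - b) / (b * b')| ≤ t / 2 := by
    rw [abs_div, abs_mul, abs_of_pos ha2, abs_of_pos (mul_pos hb0 hb3),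
      div_le_iff₀ (mul_pos hb0 hb3)]
    have h3 : a' ≤ 3 / 2 * Γ := by linarith
    calc a' * |b' - b| ≤ 3 / 2 * Γ * (c ^ 2 * t / (6 * Γ)) := by gcongr
      _ = t / 2 * (c * (c / 2)) := by field_simp; ring
      _ ≤ t / 2 * (b * b') := by gcongr
  rw [h2]
  exact (abs_sub _ _).trans (by linarith)

section Accuracy

variable {p : Params} {kappa : ℝ} {I : Type v} {A C : L2 I →L[ℝ] L2 I} {u : L2 I}
  (h : IsEigenProblem p A C u) (hp : p.Valid)
  (SA : ApplyScheme A) (SC : ApplyScheme C) (T : ApproxRoutine I p.omega kappa)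
include h hp

theorem rayl_accurate {x : I →₀ ℝ} (hx : IsApprox u p.d x) {η : ℝ} (hη : 0 < η) :
    0 < (rayl p SA SC T x η).val ∧ (rayl p SA SC T x η).val ≤ 2 * p.K ∧
      |(rayl p SA SC T x η).val - rayleigh A C (toL2 x)| ≤ η := by
  obtain ⟨hx1, hxd⟩ := hx
  have hγ := hp.gamma_pos
  have hΓ := hp.Gamma_pos
  have hc := hp.cC_pos
  have hA := h.gamma_le_inner_A hx1
  have hC := h.cC_le_inner_C hp hx1 hxd
  have hAn := h.norm_A_pos
  have hCn := h.norm_C_pos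
  set t := min η (min (p.gamma / p.cC) (3 * p.Gamma / p.cC)) with ht
  have ht0 : 0 < t := lt_min hη (lt_min (by positivity) (by positivity))
  have htγ : t ≤ p.gamma / p.cC := (min_le_right _ _).trans (min_le_left _ _)
  have htΓ : t ≤ 3 * p.Gamma / p.cC := (min_le_right _ _).trans (min_le_right _ _)
  obtain ⟨h1, h2, h3⟩ := abs_div_sub_div_le hγ hc ht0 htγ htΓ hA (h.inner_A_le hx1) hC
    (abs_scal_sub_inner_le SA T (η := t * p.cC / 2) (by positivity) hAn hx1)
    (abs_scal_sub_inner_le SC T (η := p.cC ^ 2 * t / (6 * p.Gamma)) (by positivity) hCn hx1)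
  refine ⟨div_pos h1 h2, ?_, h3.trans (min_le_left _ _)⟩
  have h4 := (abs_le.mp h3).2
  have h5 : p.gamma / p.cC = p.K := by
    have := hp.K_pos
    rw [Params.cC]; field_simp
  have h6 : rayleigh A C (toL2 x) ≤ p.K := h.rayleigh_le_K hp hx1 hxd
  rw [rayleigh] at h6
  show _ / _ ≤ _
  rw [h5] at htγ
  linarith

theorem res_accurate {x : I →₀ ℝ} (hx : IsApprox u p.d x) {η : ℝ} (hη : 0 < η) :
    ‖toL2 (res p SA SC T x η).val -
      p.alpha • shift A C (rayleigh A C (toL2 x)) (toL2 x)‖ ≤ η := by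
  have hα := hp.alpha_pos
  have hCC := hp.CC_pos
  obtain ⟨hl0, -, hl⟩ := rayl_accurate h hp SA SC T hx
    (show 0 < η / (4 * p.CC * p.alpha) by positivity)
  set l := (rayl p SA SC T x (η / (4 * p.CC * p.alpha))).val with hldef
  set wA := (SA.run x (η / (2 * p.alpha))).val with hwA
  set wC := (SC.run x (η / (4 * l * p.alpha))).val with hwC
  have hval : (res p SA SC T x η).val = p.alpha • (wA - l • wC) := rfl
  have hA := SA.accurate x (η / (2 * p.alpha)) (by positivity)
  have hC := SC.accurate x (η / (4 * l * p.alpha)) (by positivity)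
  have hCx : ‖C (toL2 x)‖ ≤ p.CC := by simpa [hx.1] using h.norm_C_apply_le (toL2 x)
  set R := rayleigh A C (toL2 x)
  have key : toL2 (p.alpha • (wA - l • wC)) - p.alpha • shift A C R (toL2 x) =
      p.alpha • (-(A (toL2 x) - toL2 wA) + l • (C (toL2 x) - toL2 wC)
        - (l - R) • C (toL2 x)) := by
    rw [toL2_smul, toL2_sub, toL2_smul, shift_apply]; module
  rw [hval, key, norm_smul, Real.norm_of_nonneg hα.le]
  have h1 : ‖-(A (toL2 x) - toL2 wA) + l • (C (toL2 x) - toL2 wC) - (l - R) • C (toL2 x)‖ ≤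
      η / (2 * p.alpha) + l * (η / (4 * l * p.alpha)) + η / (4 * p.CC * p.alpha) * p.CC := by
    refine (norm_sub_le _ _).trans (add_le_add ((norm_add_le _ _).trans (add_le_add ?_ ?_)) ?_)
    · rwa [norm_neg]
    · rw [norm_smul, Real.norm_of_nonneg hl0.le]
      gcongr
    · rw [norm_smul, Real.norm_eq_abs]
      gcongr
  calc p.alpha * _ ≤ p.alpha * (η / (2 * p.alpha) + l * (η / (4 * l * p.alpha)) +
        η / (4 * p.CC * p.alpha) * p.CC) := by gcongr
    _ = η := by field_simp; norm_num

/-- One perturbed and normalized iteration. -/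
theorem isApprox_normalize_sub {x r : I →₀ ℝ} {e η : ℝ} (hx : IsApprox u e x) (he : e ≤ p.d)
    (hη : η < 1)
    (hr : ‖toL2 r - p.alpha • shift A C (rayleigh A C (toL2 x)) (toL2 x)‖ ≤ η) :
    IsApprox u (((1 + 3 * p.beta) / 4 * e + η) / (1 - η)) (normalize (x - r)).val := by
  set g := p.alpha • shift A C (rayleigh A C (toL2 x)) (toL2 x) with hg
  have h1 : toL2 (x - r) = (toL2 x - g) - (toL2 r - g) := by
    rw [toL2_sub]; abel
  have h2 : 1 - η ≤ ‖toL2 (x - r)‖ := by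
    have h3 := h.one_le_norm_step hx.1 p.alpha
    rw [← hg] at h3
    rw [h1]
    linarith [norm_sub_norm_le (toL2 x - g) (toL2 r - g)]
  have h3 : ‖perp u (toL2 (x - r))‖ ≤ (1 + 3 * p.beta) / 4 * e + η := by
    have h4 := h.norm_perp_step_le hp hx.1 (hx.2.trans he)
    rw [← hg] at h4
    rw [h1, perp_sub]
    have h5 := norm_sub_le (perp u (toL2 x - g)) (perp u (toL2 r - g))
    have h6 := (norm_perp_le h.norm_u (toL2 r - g)).trans hr
    have h7 := mul_le_mul_of_nonneg_left hx.2
      (show 0 ≤ (1 + 3 * p.beta) / 4 by linarith [hp.beta_pos])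
    linarith
  refine ⟨norm_toL2_normalize (by linarith), ?_⟩
  rw [norm_perp_normalize]
  exact div_le_div₀ ((norm_nonneg _).trans h3) h3 (by linarith) h2

/-- The residual test certifies the accuracy that the coarsening step asks for. -/
theorem isApprox_of_residual_le {x r : I →₀ ℝ} {e η ebar : ℝ} (hx : IsApprox u e x)
    (he : e ≤ min p.d (p.deltaBar ‖C‖)) (hM : 2 * invNorm A C u p.lam ≤ p.M)
    (hr : ‖toL2 r - p.alpha • shift A C (rayleigh A C (toL2 x)) (toL2 x)‖ ≤ η)
    (hsmall : η + ‖toL2 r‖ ≤ p.alpha * p.c1 * ebar / p.M) :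
    IsApprox u (p.c1 * ebar) x := by
  refine ⟨hx.1, ?_⟩
  have hM0 := hp.M_pos
  have hα := hp.alpha_pos
  have h1 := h.norm_perp_le_mul_norm_residual hp hM hx.1
    (hx.2.trans (he.trans (min_le_left _ _))) (hx.2.trans (he.trans (min_le_right _ _)))
  set g := shift A C (rayleigh A C (toL2 x)) (toL2 x) with hg
  have h2 : p.alpha * ‖g‖ ≤ p.alpha * p.c1 * ebar / p.M := by
    have h3 : ‖p.alpha • g‖ ≤ ‖toL2 r‖ + η := by
      rw [norm_sub_rev] at hr
      linarith [norm_sub_norm_le (p.alpha • g) (toL2 r)]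
    rw [norm_smul, Real.norm_of_nonneg hα.le] at h3
    linarith
  rw [le_div_iff₀ hM0] at h2
  have h3 : p.M * ‖g‖ ≤ p.c1 * ebar := by
    refine le_of_mul_le_mul_left ?_ hα
    linarith
  exact h1.trans h3

/-- Coarsening and renormalization halve the error bound. -/
theorem isApprox_normalize_approx {x : I →₀ ℝ} {ebar : ℝ} (he0 : 0 < ebar) (he : ebar ≤ p.eps0)
    (hx : IsApprox u (p.c1 * ebar) x) :
    IsApprox u (ebar / 2)
      (normalize (T.run x (3 * p.c1 * ebar / (Real.sqrt 2 * p.omega))).val).val := by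
  have hc := hp.c1_pos
  have hω := hp.omega_ge
  set δ := 3 * p.c1 * ebar / (Real.sqrt 2 * p.omega) with hδ
  have hs2 : Real.sqrt 2 ≤ 1.4143 := by
    rw [Real.sqrt_le_left (by norm_num)]; norm_num
  have hδ0 : 0 < δ := by positivity
  have hδ1 : δ ≤ 4.2429 * (p.c1 * ebar) := by
    rw [hδ, div_le_iff₀ (by positivity)]
    have h1 : (Real.sqrt 2) * Real.sqrt 2 = 2 := Real.mul_self_sqrt (by norm_num)
    have h2 : (1.4142 : ℝ) ≤ Real.sqrt 2 := Real.le_sqrt_of_sq_le (by norm_num)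
    have h3 : 0 < p.c1 * ebar := by positivity
    have h4 : 3 ≤ 4.2429 * (Real.sqrt 2 * p.omega) := by nlinarith
    nlinarith
  set z := (T.run x δ).val
  have hz := T.accurate x δ hδ0
  have h1 : 1 - δ ≤ ‖toL2 z‖ := by
    have := norm_sub_norm_le (toL2 x) (toL2 z)
    rw [hx.1] at this
    linarith
  have h2 : ‖perp u (toL2 z)‖ ≤ p.c1 * ebar + δ := by
    have h3 : toL2 z = toL2 x - (toL2 x - toL2 z) := by abel
    rw [h3, perp_sub]
    exact (norm_sub_le _ _).trans
      (add_le_add hx.2 ((norm_perp_le h.norm_u _).trans hz))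
  have h3 := hp.c1_lt
  have h4 := hp.eps0_le_quarter
  have h5 : p.c1 * ebar ≤ 0.0836 * ebar := by gcongr
  have h6 : 0 < 1 - δ := by linarith
  refine ⟨norm_toL2_normalize (by linarith), ?_⟩
  rw [norm_perp_normalize]
  refine (div_le_div₀ ((norm_nonneg _).trans h2) h2 h6 h1).trans ?_
  rw [div_le_iff₀ h6]
  nlinarith

end Accuracy

/-! ### The error recursion in an iteration block -/

namespace Params.Valid

variable {p : Params} (hp : p.Valid)
include hp

omit hp in
theorem beta_le_xi_sq : p.beta ≤ p.xi ^ 2 := by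
  unfold xi
  nlinarith [sq_nonneg (1 - p.beta)]

/-- The error bound `min 1 (ξ ^ j / β) * ebar` after `j` iterations reproduces itself.  For
`j ≤ 2` the minimum is `1`; afterwards the tolerances have become small enough for the factor
`ξ`. -/
theorem error_recursion {ebar e : ℝ} (he0 : 0 < ebar) (he : ebar ≤ p.eps0) (j : ℕ)
    (h1 : e ≤ ebar) (h2 : p.beta * e ≤ ebar * p.xi ^ j) :
    (1 - p.xi) * ebar / 2 ^ j < 1 ∧
    ((1 + 3 * p.beta) / 4 * e + (1 - p.xi) * ebar / 2 ^ j) / (1 - (1 - p.xi) * ebar / 2 ^ j) ≤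
      ebar ∧
    p.beta * (((1 + 3 * p.beta) / 4 * e + (1 - p.xi) * ebar / 2 ^ j) /
      (1 - (1 - p.xi) * ebar / 2 ^ j)) ≤ ebar * p.xi ^ (j + 1) := by
  have hβ := hp.beta_pos
  have hβ1 := hp.beta_lt
  have hξ := hp.half_lt_xi
  have hξ1 := hp.xi_lt
  have hq := hp.eps0_le_quarter
  have hxi : p.xi = (1 + p.beta) / 2 := rfl
  have hpow1 : (1 / 2 : ℝ) ^ j ≤ 1 := pow_le_one₀ (by norm_num) (by norm_num)
  have hpow0 : (0 : ℝ) < (1 / 2 : ℝ) ^ j := by positivity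
  have hη : (1 - p.xi) * ebar / 2 ^ j = (1 - p.xi) * ebar * (1 / 2) ^ j := by
    rw [one_div, inv_pow, div_eq_mul_inv]
  rw [hη]
  set q : ℝ := (1 / 2 : ℝ) ^ j with hqdef
  have hη1 : (1 - p.xi) * ebar * q ≤ (1 - p.xi) * ebar := by
    refine mul_le_of_le_one_right (by nlinarith) hpow1
  have hη2 : (1 - p.xi) * ebar * q ≤ (1 - p.beta) / 8 := by nlinarith
  have hη3 : 0 < 1 - (1 - p.xi) * ebar * q := by linarith
  have first : ((1 + 3 * p.beta) / 4 * e + (1 - p.xi) * ebar * q) /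
      (1 - (1 - p.xi) * ebar * q) ≤ ebar := by
    rw [div_le_iff₀ hη3]
    have h3 : (1 + 3 * p.beta) / 4 * e ≤ (1 + 3 * p.beta) / 4 * ebar := by gcongr
    have h4 : (1 - p.xi) * ebar * q * ebar ≤ (1 - p.beta) / 8 * ebar := by gcongr
    have h5 : (1 - p.xi) * ebar = (1 - p.beta) / 2 * ebar := by rw [hxi]; ring
    have h6 : 0 ≤ (1 - p.beta) * ebar := mul_nonneg (by linarith) he0.le
    linarith
  refine ⟨by linarith, first, ?_⟩
  have small : p.beta ≤ p.xi ^ (j + 1) → p.beta * (((1 + 3 * p.beta) / 4 * e +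
      (1 - p.xi) * ebar * q) / (1 - (1 - p.xi) * ebar * q)) ≤ ebar * p.xi ^ (j + 1) := by
    intro h3
    calc _ ≤ p.beta * ebar := by gcongr
      _ ≤ ebar * p.xi ^ (j + 1) := by rw [mul_comm]; gcongr
  rcases lt_or_ge j 2 with hj | hj
  · refine small (beta_le_xi_sq.trans ?_)
    exact pow_le_pow_of_le_one (by linarith) hξ1.le (by omega)
  · have h3 : 4 * p.beta * q ≤ p.xi ^ j := by
      obtain ⟨m, rfl⟩ := Nat.exists_eq_add_of_le hj
      rw [hqdef, pow_add, pow_add]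
      have h4 : (1 / 2 : ℝ) ^ m ≤ p.xi ^ m := by gcongr
      calc 4 * p.beta * ((1 / 2) ^ 2 * (1 / 2) ^ m) = p.beta * (1 / 2) ^ m := by ring
        _ ≤ p.xi ^ 2 * p.xi ^ m := by
            gcongr
            exact beta_le_xi_sq
    rw [← mul_div_assoc, div_le_iff₀ hη3, pow_succ]
    set X := p.xi ^ j with hX
    have hX0 : 0 < X := by positivity
    have h4 : p.beta * ((1 + 3 * p.beta) / 4 * e) ≤ (1 + 3 * p.beta) / 4 * (ebar * X) := by
      calc _ = (1 + 3 * p.beta) / 4 * (p.beta * e) := by ring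
        _ ≤ _ := by gcongr
    have h5 : p.beta * ((1 - p.xi) * ebar * q) ≤ (1 - p.xi) * ebar / 4 * X := by
      calc _ = (1 - p.xi) * ebar / 4 * (4 * p.beta * q) := by ring
        _ ≤ _ := by
          have : 0 ≤ 1 - p.xi := by linarith
          gcongr
    have h6 : ebar * (X * p.xi) * ((1 - p.xi) * ebar * q) ≤ ebar * X * ((1 - p.beta) / 8) := by
      calc _ ≤ ebar * (X * 1) * ((1 - p.beta) / 8) := by
            gcongr
        _ = _ := by ring
    have h7 : (1 + 3 * p.beta) / 4 * (ebar * X) + (1 - p.xi) * ebar / 4 * X +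
        ebar * X * ((1 - p.beta) / 8) = ebar * (X * p.xi) := by
      rw [hxi]; ring
    linarith

/-- The number of iterations after which an iteration block ends at the latest. -/
theorem xi_pow_le_of_log_le {j : ℕ} (hj : Real.log (p.c1 * p.beta) / Real.log p.xi ≤ j) :
    p.xi ^ j ≤ p.c1 * p.beta := by
  have hξ : 0 < p.xi := by linarith [hp.half_lt_xi]
  have h1 : Real.log p.xi < 0 := Real.log_neg hξ hp.xi_lt
  rw [div_le_iff_of_neg h1] at hj
  rw [← Real.log_le_log_iff (by positivity) (mul_pos hp.c1_pos hp.beta_pos), Real.log_pow]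
  exact hj

end Params.Valid

/-! ### Operation counts of the routines -/

/-- The number of entries, up to constants, that an approximation of accuracy `ε` needs for an
element of quasi-norm `W` of the approximation space of order `s`. -/
def budget (s W ε : ℝ) : ℝ := (W / ε) ^ (1 / s)

section Budget

variable {s W ε : ℝ}

theorem one_le_budget (hs : 0 < s) (hW : 1 ≤ W) (hε : 0 < ε) (hε1 : ε ≤ 1) :
    1 ≤ budget s W ε :=
  Real.one_le_rpow ((one_le_div hε).mpr (hε1.trans hW)) (by positivity)

theorem budget_half (hW : 0 ≤ W) (hε : 0 < ε) :
    budget s W (ε / 2) = 2 ^ (1 / s) * budget s W ε := by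
  rw [budget, budget, ← Real.mul_rpow (by norm_num) (by positivity)]
  congr 1
  field_simp

theorem budget_le_mul {σ ε' : ℝ} (hs : 0 < s) (hW : 0 ≤ W) (hσ : 0 < σ) (hε' : 0 < ε')
    (h : σ * ε' ≤ ε) : budget s W ε ≤ (1 / σ) ^ (1 / s) * budget s W ε' := by
  have hε : 0 < ε := (mul_pos hσ hε').trans_le h
  rw [budget, budget, ← Real.mul_rpow (by positivity) (by positivity)]
  refine Real.rpow_le_rpow (by positivity) ?_ (by positivity)
  calc W / ε ≤ W / (σ * ε') := by gcongr
    _ = 1 / σ * (W / ε') := by field_simp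

theorem budget_min_one (hs : 0 < s) (hW : 0 ≤ W) (hε : 0 < ε) :
    budget s W (min 1 ε) = max 1 (ε ^ (-(1 / s))) * W ^ (1 / s) := by
  have h0 : 0 < 1 / s := by positivity
  rw [budget, Real.div_rpow hW (by positivity), div_eq_inv_mul]
  congr 1
  rcases le_total ε 1 with h | h
  · rw [min_eq_right h, max_eq_right, Real.rpow_neg hε.le]
    exact Real.one_le_rpow_of_pos_of_le_one_of_nonpos hε h (by linarith)
  · rw [min_eq_left h, max_eq_left, Real.one_rpow, inv_one]
    exact Real.rpow_le_one_of_one_le_of_nonpos h (by linarith)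

end Budget

/-- The vector `x` has quasi-norm at most `H * W` and at most `D` times the number of entries that
accuracy `ε` permits. -/
structure IsControlled {I : Type v} (s W ε H D : ℝ) (x : I →₀ ℝ) : Prop where
  s_pos : 0 < s
  one_le_W : 1 ≤ W
  eps_pos : 0 < ε
  eps_le : ε ≤ 1
  H_nonneg : 0 ≤ H
  D_nonneg : 0 ≤ D
  norm_le : asNorm s (toL2 x) ≤ H * W
  card_le : (x.support.card : ℝ) ≤ D * budget s W ε

theorem IsControlled.one_le_budget {I : Type v} {s W ε H D : ℝ} {x : I →₀ ℝ}
    (h : IsControlled s W ε H D x) : 1 ≤ budget s W ε :=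
  AdaptiveEigen.one_le_budget h.s_pos h.one_le_W h.eps_pos h.eps_le

/-- Near the eigenvector a bound for the number of entries entails one for the quasi-norm. -/
theorem IsApprox.isControlled {I : Type v} {u : L2 I} (hu : ‖u‖ = 1) {s ε D : ℝ} {x : I →₀ ℝ}
    (hx : IsApprox u ε x) (hs : 0 < s) (hmem : MemAs s u) (hε : 0 < ε) (hε1 : ε ≤ 1)
    (hD : 0 ≤ D) (hcard : (x.support.card : ℝ) ≤ D * budget s (asNorm s u) ε) :
    IsControlled s (asNorm s u) ε (2 + D ^ s) D x where
  s_pos := hs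
  one_le_W := hu ▸ norm_le_asNorm s u
  eps_pos := hε
  eps_le := hε1
  H_nonneg := by positivity
  D_nonneg := hD
  norm_le := asNorm_toL2_le hs hmem hε hD (abs_inner_le_one hu hx.1)
    (by rw [hx.1, ← hu]; exact norm_le_asNorm s u)
    (by rw [← perp_eq hu]; exact hx.2) hcard
  card_le := hcard

/-- The constant in the cost of an application with tolerance at least `ρ * ε`. -/
def applyCost (c s H D ρ : ℝ) : ℝ := |c| * ((H / ρ) ^ (1 / s) + D + 1)

/-- The constant in the cost of `RAYL`, in terms of the one for the applications. -/
def raylCost (κ D L : ℝ) : ℝ := 2 * (κ * (D + 1) + L + 2 * D + 3) + 5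

/-- The constant in the cost of `RES`. -/
def resCost (κ D L : ℝ) : ℝ := raylCost κ D L + 7 * L + 8

/-- The constant in the cost of an iteration, which is a call of `RES`, a subtraction and a
normalization. -/
def iterCost (κ D L : ℝ) : ℝ := resCost κ D L + 12 * L + 4 * D + 10

theorem applyCost_nonneg {c s H D ρ : ℝ} (hH : 0 ≤ H) (hD : 0 ≤ D) (hρ : 0 < ρ) :
    0 ≤ applyCost c s H D ρ := by
  unfold applyCost; positivity

theorem apply_cost {I : Type v} {B : L2 I →L[ℝ] L2 I} {S : ApplyScheme B} {sstar : ℝ}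
    {cApply : ℝ → ℝ} (hS : S.IsSparse sstar cApply) {s W ε H D ρ δ : ℝ} (hs : s < sstar)
    {x : I →₀ ℝ} (hx : IsControlled s W ε H D x) (hρ : 0 < ρ) (hδ : ρ * ε ≤ δ) :
    ((S.run x δ).val.support.card : ℝ) ≤ applyCost (cApply s) s H D ρ * budget s W ε ∧
    ((S.run x δ).flops : ℝ) ≤ applyCost (cApply s) s H D ρ * budget s W ε := by
  have hs0 := hx.s_pos
  have hε := hx.eps_pos
  have hW := hx.one_le_W
  have hH := hx.H_nonneg
  have hδ0 : 0 < δ := (mul_pos hρ hε).trans_le hδ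
  have hX := hx.one_le_budget
  set X := budget s W ε with hXdef
  obtain ⟨-, h2, h3⟩ := hS s hs0 hs x δ hδ0
  have hn := asNorm_nonneg s (toL2 x)
  have h4 : asNorm s (toL2 x) ^ (1 / s) * δ ^ (-(1 / s)) ≤ (H / ρ) ^ (1 / s) * X := by
    rw [Real.rpow_neg hδ0.le, ← div_eq_mul_inv, ← Real.div_rpow hn hδ0.le, hXdef, budget,
      ← Real.mul_rpow (by positivity) (by positivity)]
    refine Real.rpow_le_rpow (by positivity) ?_ (by positivity)
    calc asNorm s (toL2 x) / δ ≤ H * W / (ρ * ε) := by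
          gcongr
          exact hx.norm_le
      _ = H / ρ * (W / ε) := by field_simp
  have hD := hx.D_nonneg
  have h5 : asNorm s (toL2 x) ^ (1 / s) * δ ^ (-(1 / s)) + x.support.card + 1 ≤
      ((H / ρ) ^ (1 / s) + D + 1) * X := by
    linarith [hx.card_le]
  have h0 : 0 ≤ asNorm s (toL2 x) ^ (1 / s) * δ ^ (-(1 / s)) := by positivity
  have habs := le_abs_self (cApply s)
  have h6 : |cApply s| * (asNorm s (toL2 x) ^ (1 / s) * δ ^ (-(1 / s)) + x.support.card + 1) ≤
      applyCost (cApply s) s H D ρ * X := by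
    rw [applyCost, mul_assoc]
    gcongr
  constructor
  · refine h2.trans (le_trans ?_ h6)
    refine mul_le_mul habs ?_ h0 (abs_nonneg _)
    have : (0 : ℝ) ≤ x.support.card := by positivity
    linarith
  · refine h3.trans (le_trans ?_ h6)
    exact mul_le_mul_of_nonneg_right habs (by positivity)

theorem ApproxRoutine.kappa_nonneg {I : Type v} {omega kappa : ℝ}
    (T : ApproxRoutine I omega kappa) : 0 ≤ kappa := by
  have h1 := T.linear 0 1 one_pos
  simp only [Finsupp.support_zero, Finset.card_empty, Nat.cast_zero, zero_add, mul_one] at h1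
  exact (Nat.cast_nonneg _).trans h1

theorem ApproxRoutine.flops_le {I : Type v} {omega kappa s W ε H D η : ℝ}
    (T : ApproxRoutine I omega kappa) {x : I →₀ ℝ} (hx : IsControlled s W ε H D x) (hη : 0 < η) :
    ((T.run x η).flops : ℝ) ≤ kappa * (D + 1) * budget s W ε := by
  have h1 := T.kappa_nonneg
  refine (T.linear x η hη).trans ?_
  rw [mul_assoc]
  gcongr
  linarith [hx.card_le, hx.one_le_budget]

theorem scal_cost {I : Type v} {omega kappa : ℝ} {B : L2 I →L[ℝ] L2 I} {S : ApplyScheme B}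
    {sstar : ℝ} {cApply : ℝ → ℝ} (hS : S.IsSparse sstar cApply) (hB : 0 < ‖B‖)
    (T : ApproxRoutine I omega kappa) {s W ε H D ρ η : ℝ} (hs : s < sstar) {x : I →₀ ℝ}
    (hx : IsControlled s W ε H D x) (hρ : 0 < ρ) (hη : ρ * ε ≤ η / 2) :
    ((scal S T x η).flops : ℝ) ≤
      (kappa * (D + 1) + applyCost (cApply s) s H D ρ + 2 * D + 3) * budget s W ε := by
  have hη0 : 0 < η / 2 := (mul_pos hρ hx.eps_pos).trans_le hη
  have hη1 : 0 < η / (2 * ‖B‖) := by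
    rw [← div_div]; positivity
  have h1 := T.flops_le hx hη1
  have h2 := (apply_cost hS hs hx hρ hη).2
  have h3 : ((T.run x (η / (2 * ‖B‖))).val.support.card : ℝ) ≤ D * budget s W ε :=
    (Nat.cast_le.mpr (card_support_le_of_restricts (T.restricts x _ hη1))).trans hx.card_le
  have h4 := hx.one_le_budget
  simp only [scal]
  push_cast
  linarith

/-- If `RAYL` is called with tolerance at least `τ * ε`, then the applications it makes have
tolerance at least `raylTol p τ * ε`. -/
def raylTol (p : Params) (τ : ℝ) : ℝ :=
  min τ (min (p.gamma / p.cC) (3 * p.Gamma / p.cC)) * min (p.cC / 4) (p.cC ^ 2 / (12 * p.Gamma))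

theorem raylTol_pos {p : Params} (hp : p.Valid) {τ : ℝ} (hτ : 0 < τ) : 0 < raylTol p τ := by
  have h1 := hp.cC_pos
  have h2 := hp.gamma_pos
  have h3 := hp.Gamma_pos
  unfold raylTol; positivity

theorem rayl_cost {p : Params} (hp : p.Valid) {I : Type v} {kappa : ℝ} {A C : L2 I →L[ℝ] L2 I}
    {SA : ApplyScheme A} {SC : ApplyScheme C} (T : ApproxRoutine I p.omega kappa) {sstar : ℝ}
    {cApply : ℝ → ℝ} (hSA : SA.IsSparse sstar cApply) (hSC : SC.IsSparse sstar cApply)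
    (hA : 0 < ‖A‖) (hC : 0 < ‖C‖) {s W ε H D ρ τ η : ℝ} (hs : s < sstar) {x : I →₀ ℝ}
    (hx : IsControlled s W ε H D x) (hρ : 0 < ρ) (hρτ : ρ ≤ raylTol p τ) (hτ : 0 < τ)
    (hη : τ * ε ≤ η) :
    ((rayl p SA SC T x η).flops : ℝ) ≤
      raylCost kappa D (applyCost (cApply s) s H D ρ) * budget s W ε := by
  have h1 := hp.cC_pos
  have h2 := hp.gamma_pos
  have h3 := hp.Gamma_pos
  have hε := hx.eps_pos
  have hε1 := hx.eps_le
  set b := min (p.gamma / p.cC) (3 * p.Gamma / p.cC) with hb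
  have hb0 : 0 < b := by positivity
  have ht : min τ b * ε ≤ min η b := by
    refine le_min (le_trans ?_ hη) ?_
    · gcongr
      exact min_le_left _ _
    · calc min τ b * ε ≤ b * 1 := by
            gcongr
            exact min_le_right _ _
        _ = b := mul_one b
  have ht0 : 0 ≤ min η b := le_trans (by positivity) ht
  have key : ∀ m, min (p.cC / 4) (p.cC ^ 2 / (12 * p.Gamma)) ≤ m → ρ * ε ≤ min η b * m := by
    intro m hm
    have hm0 : 0 < min (p.cC / 4) (p.cC ^ 2 / (12 * p.Gamma)) := by positivity
    calc ρ * ε ≤ raylTol p τ * ε := by gcongr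
      _ = (min τ b * ε) * min (p.cC / 4) (p.cC ^ 2 / (12 * p.Gamma)) := by
          rw [raylTol, ← hb]; ring
      _ ≤ min η b * m := by gcongr
  have e1 := scal_cost hSA hA T (η := min η b * p.cC / 2) hs hx hρ
    ((key _ (min_le_left _ _)).trans_eq (by ring))
  have e2 := scal_cost hSC hC T (η := p.cC ^ 2 * min η b / (6 * p.Gamma)) hs hx hρ
    ((key _ (min_le_right _ _)).trans_eq (by field_simp; ring))
  have h4 := hx.one_le_budget
  simp only [rayl, ← hb, raylCost]
  push_cast
  linarith

/-- If `RES` is called with tolerance at least `τ * ε`, then the applications it makes have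
tolerance at least `resTol p τ * ε`; the factor `8 * K` accounts for the bound `2 * K` of the
computed Rayleigh quotient. -/
def resTol (p : Params) (τ : ℝ) : ℝ :=
  min (raylTol p (τ / (4 * p.CC * p.alpha))) (min (τ / (2 * p.alpha)) (τ / (8 * p.K * p.alpha)))

theorem resTol_pos {p : Params} (hp : p.Valid) {τ : ℝ} (hτ : 0 < τ) : 0 < resTol p τ := by
  have h1 := hp.alpha_pos
  have h2 := hp.CC_pos
  have h3 := hp.K_pos
  have h4 := raylTol_pos hp (show 0 < τ / (4 * p.CC * p.alpha) by positivity)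
  unfold resTol; positivity

theorem res_cost {p : Params} {I : Type v} {kappa : ℝ} {A C : L2 I →L[ℝ] L2 I} {u : L2 I}
    (h : IsEigenProblem p A C u) (hp : p.Valid)
    {SA : ApplyScheme A} {SC : ApplyScheme C} (T : ApproxRoutine I p.omega kappa) {sstar : ℝ}
    {cApply : ℝ → ℝ} (hSA : SA.IsSparse sstar cApply) (hSC : SC.IsSparse sstar cApply)
    {s W ε H D τ η : ℝ} (hs : s < sstar) {x : I →₀ ℝ} (hxd : IsApprox u p.d x)
    (hx : IsControlled s W ε H D x) (hτ : 0 < τ) (hη : τ * ε ≤ η) :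
    ((res p SA SC T x η).val.support.card : ℝ) ≤
      2 * applyCost (cApply s) s H D (resTol p τ) * budget s W ε ∧
    ((res p SA SC T x η).flops : ℝ) ≤
      resCost kappa D (applyCost (cApply s) s H D (resTol p τ)) * budget s W ε := by
  have h1 := hp.alpha_pos
  have h2 := hp.CC_pos
  have h3 := hp.K_pos
  have hε := hx.eps_pos
  have hη0 : 0 < η := (mul_pos hτ hε).trans_le hη
  have hρ := resTol_pos hp hτ
  obtain ⟨hl0, hlK, -⟩ := rayl_accurate h hp SA SC T hxd
    (show 0 < η / (4 * p.CC * p.alpha) by positivity)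
  have e1 := rayl_cost hp T hSA hSC h.norm_A_pos h.norm_C_pos
    (τ := τ / (4 * p.CC * p.alpha)) (η := η / (4 * p.CC * p.alpha)) hs hx hρ
    (min_le_left _ _) (by positivity) (by rw [div_mul_eq_mul_div]; gcongr)
  set l := (rayl p SA SC T x (η / (4 * p.CC * p.alpha))).val with hl
  obtain ⟨a1, a2⟩ := apply_cost hSA (δ := η / (2 * p.alpha)) hs hx hρ (by
    calc resTol p τ * ε ≤ τ / (2 * p.alpha) * ε := by
          gcongr
          exact (min_le_right _ _).trans (min_le_left _ _)
      _ = τ * ε / (2 * p.alpha) := by ring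
      _ ≤ η / (2 * p.alpha) := by gcongr)
  obtain ⟨c1, c2⟩ := apply_cost hSC (δ := η / (4 * l * p.alpha)) hs hx hρ (by
    calc resTol p τ * ε ≤ τ / (8 * p.K * p.alpha) * ε := by
          gcongr
          exact (min_le_right _ _).trans (min_le_right _ _)
      _ = τ * ε / (4 * (2 * p.K) * p.alpha) := by ring
      _ ≤ η / (4 * l * p.alpha) := by gcongr)
  have h4 := hx.one_le_budget
  constructor
  · have h5 : (res p SA SC T x η).val.support.card ≤
        (SA.run x (η / (2 * p.alpha))).val.support.card +
          (SC.run x (η / (4 * l * p.alpha))).val.support.card := by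
      exact (card_support_smul_le _ _).trans ((card_support_sub_le _ _).trans
        (Nat.add_le_add_left (card_support_smul_le _ _) _))
    have h6 : ((res p SA SC T x η).val.support.card : ℝ) ≤
        (SA.run x (η / (2 * p.alpha))).val.support.card +
          (SC.run x (η / (4 * l * p.alpha))).val.support.card := by exact_mod_cast h5
    linarith
  · simp only [res, ← hl, resCost]
    push_cast
    linarith

/-! ### Runs of the eigensolver -/

section Run

variable {p : Params} {kappa : ℝ} {I : Type v} {A C : L2 I →L[ℝ] L2 I}
  {SA : ApplyScheme A} {SC : ApplyScheme C} {T : ApproxRoutine I p.omega kappa}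
  {x0 : I →₀ ℝ} {eps : ℝ}

theorem minieig_succ {n f : ℕ} {q : State I} (h : minieig p SA SC T x0 eps n = ⟨q, f⟩) :
    minieig p SA SC T x0 eps (n + 1) =
      ⟨(step p SA SC T eps q).val, f + (step p SA SC T eps q).flops⟩ := by
  rw [minieig, h]

theorem step_iterate_of_residual_le {ebar η : ℝ} {w : I →₀ ℝ} {j : ℕ}
    (h : η + ‖toL2 (res p SA SC T w η).val‖ ≤ p.alpha * p.c1 * ebar / p.M) :
    step p SA SC T eps (.iterate ebar w η j) =
      ⟨.coarsen ebar w,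
        (res p SA SC T w η).flops + 2 * (res p SA SC T w η).val.support.card + 5⟩ := by
  simp only [step, if_pos h]

theorem step_iterate_of_log_le {ebar η : ℝ} {w : I →₀ ℝ} {j : ℕ}
    (h : ¬ η + ‖toL2 (res p SA SC T w η).val‖ ≤ p.alpha * p.c1 * ebar / p.M)
    (hj : Real.log (p.c1 * p.beta) / Real.log p.xi ≤ (j + 1 : ℕ)) :
    step p SA SC T eps (.iterate ebar w η j) =
      ⟨.coarsen ebar (normalize (w - (res p SA SC T w η).val)).val,
        (res p SA SC T w η).flops + 2 * (res p SA SC T w η).val.support.card + 5 +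
          w.support.card + (res p SA SC T w η).val.support.card +
          (normalize (w - (res p SA SC T w η).val)).flops + 3⟩ := by
  simp only [step, if_neg h, if_pos hj]

theorem step_iterate_of_lt_log {ebar η : ℝ} {w : I →₀ ℝ} {j : ℕ}
    (h : ¬ η + ‖toL2 (res p SA SC T w η).val‖ ≤ p.alpha * p.c1 * ebar / p.M)
    (hj : ¬ Real.log (p.c1 * p.beta) / Real.log p.xi ≤ (j + 1 : ℕ)) :
    step p SA SC T eps (.iterate ebar w η j) =
      ⟨.iterate ebar (normalize (w - (res p SA SC T w η).val)).val (η / 2) (j + 1),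
        (res p SA SC T w η).flops + 2 * (res p SA SC T w η).val.support.card + 5 +
          w.support.card + (res p SA SC T w η).val.support.card +
          (normalize (w - (res p SA SC T w η).val)).flops + 3⟩ := by
  simp only [step, if_neg h, if_neg hj]

theorem step_coarsen_of_le {ebar : ℝ} {w : I →₀ ℝ} (h : ebar / 2 ≤ p.target eps) :
    step p SA SC T eps (.coarsen ebar w) =
      let z := T.run w (3 * p.c1 * ebar / (Real.sqrt 2 * p.omega))
      let n := normalize z.val
      ⟨.halted (rayl p SA SC T n.val (eps / 2)).val n.val,
        z.flops + n.flops + 6 + (rayl p SA SC T n.val (eps / 2)).flops⟩ := by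
  simp only [step, if_pos h]

theorem step_coarsen_of_lt {ebar : ℝ} {w : I →₀ ℝ} (h : ¬ ebar / 2 ≤ p.target eps) :
    step p SA SC T eps (.coarsen ebar w) =
      let z := T.run w (3 * p.c1 * ebar / (Real.sqrt 2 * p.omega))
      let n := normalize z.val
      ⟨.iterate (ebar / 2) n.val ((1 - p.xi) * (ebar / 2)) 0, z.flops + n.flops + 6⟩ := by
  simp only [step, if_neg h]

end Run

/-! ### The iteration block -/

/-- A bound for the number of iterations in a block. -/
def maxIter (p : Params) : ℕ := ⌈Real.log (p.c1 * p.beta) / Real.log p.xi⌉₊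

/-- All residuals of a block of accuracy `ebar` are computed with tolerance at least
`blockTol p * ebar`. -/
def blockTol (p : Params) : ℝ := (1 - p.xi) / 2 ^ maxIter p

/-- The constant of the applications in a block, for an iterate with support constant `D`; the
quasi-norm constant is the one of `IsApprox.isControlled`. -/
def blockApplyCost (p : Params) (c s D : ℝ) : ℝ :=
  applyCost c s (2 + D ^ s) D (resTol p (blockTol p))

/-- A bound, in units of the budget, for both the number of entries of the iterate and the number
of operations after `j` iterations of a block that is started with support constant `D`. -/
def iterConst (p : Params) (κ c s D : ℝ) : ℕ → ℝ
  | 0 => D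
  | j + 1 => iterConst p κ c s D j +
      iterCost κ (iterConst p κ c s D j) (blockApplyCost p c s (iterConst p κ c s D j))

section Block

variable {p : Params} (hp : p.Valid)
include hp

theorem blockTol_pos : 0 < blockTol p :=
  div_pos (by linarith [hp.xi_lt]) (by positivity)

theorem blockTol_mul_le {ebar : ℝ} (he : 0 < ebar) {j : ℕ} (hj : j ≤ maxIter p) :
    blockTol p * ebar ≤ (1 - p.xi) * ebar / 2 ^ j := by
  have h1 := hp.xi_lt
  rw [blockTol, div_mul_eq_mul_div]
  have h2 : 0 ≤ (1 - p.xi) * ebar := mul_nonneg (by linarith) he.le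
  gcongr
  norm_num

theorem blockApplyCost_nonneg {c s D : ℝ} (hD : 0 ≤ D) : 0 ≤ blockApplyCost p c s D :=
  applyCost_nonneg (by positivity) hD (resTol_pos hp (blockTol_pos hp))

omit hp in
theorem iterCost_nonneg {κ D L : ℝ} (hκ : 0 ≤ κ) (hD : 0 ≤ D) (hL : 0 ≤ L) :
    0 ≤ iterCost κ D L := by
  unfold iterCost resCost raylCost; positivity

theorem iterConst_nonneg {κ c s D : ℝ} (hκ : 0 ≤ κ) (hD : 0 ≤ D) (j : ℕ) :
    0 ≤ iterConst p κ c s D j := by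
  induction j with
  | zero => exact hD
  | succ j ih => exact add_nonneg ih (iterCost_nonneg hκ ih (blockApplyCost_nonneg hp ih))

theorem iterConst_monotone {κ c s D : ℝ} (hκ : 0 ≤ κ) (hD : 0 ≤ D) :
    Monotone (iterConst p κ c s D) :=
  monotone_nat_of_le_succ fun j => le_add_of_nonneg_right <|
    iterCost_nonneg hκ (iterConst_nonneg hp hκ hD j)
      (blockApplyCost_nonneg hp (iterConst_nonneg hp hκ hD j))

variable {kappa : ℝ} {I : Type v} {A C : L2 I →L[ℝ] L2 I} {u : L2 I}
  {SA : ApplyScheme A} {SC : ApplyScheme C} {T : ApproxRoutine I p.omega kappa}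
  {x0 : I →₀ ℝ} {eps : ℝ} (h : IsEigenProblem p A C u)
include h

/-- After one iteration the number of entries of the iterate is still bounded in units of the
budget, and so is the number of operations that the iteration takes. -/
theorem iterate_cost {sstar : ℝ} {cApply : ℝ → ℝ} (hSA : SA.IsSparse sstar cApply)
    (hSC : SC.IsSparse sstar cApply) {ebar η : ℝ} (he0 : 0 < ebar) (he : ebar ≤ p.eps0)
    (hη : blockTol p * ebar ≤ η) {x : I →₀ ℝ} (hx : IsApprox u ebar x) {s D : ℝ} (hs0 : 0 < s)
    (hs : s < sstar) (hmem : MemAs s u) (hD : 0 ≤ D)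
    (hcard : (x.support.card : ℝ) ≤ D * budget s (asNorm s u) ebar) :
    ((normalize (x - (res p SA SC T x η).val)).val.support.card : ℝ) ≤
      (D + iterCost kappa D (blockApplyCost p (cApply s) s D)) * budget s (asNorm s u) ebar ∧
    (((res p SA SC T x η).flops + 2 * (res p SA SC T x η).val.support.card + 5 +
          x.support.card + (res p SA SC T x η).val.support.card +
          (normalize (x - (res p SA SC T x η).val)).flops + 3 : ℕ) : ℝ) ≤
      iterCost kappa D (blockApplyCost p (cApply s) s D) * budget s (asNorm s u) ebar := by
  have hctl := hx.isControlled h.norm_u hs0 hmem he0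
    (he.trans (hp.eps0_le_quarter.trans (by norm_num))) hD hcard
  obtain ⟨h1, h2⟩ := res_cost h hp T hSA hSC hs (hx.mono (he.trans hp.eps0_le)) hctl
    (blockTol_pos hp) hη
  have hX := hctl.one_le_budget
  have hL := blockApplyCost_nonneg hp (c := cApply s) (s := s) hD
  have hκ := T.kappa_nonneg
  have hsub : ((x - (res p SA SC T x η).val).support.card : ℝ) ≤
      x.support.card + (res p SA SC T x η).val.support.card := by
    exact_mod_cast card_support_sub_le _ _
  have hnorm : ((normalize (x - (res p SA SC T x η).val)).val.support.card : ℝ) ≤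
      (x - (res p SA SC T x η).val).support.card := by
    exact_mod_cast card_support_normalize_le _
  change _ ≤ 2 * blockApplyCost p (cApply s) s D * _ at h1
  change _ ≤ resCost kappa D (blockApplyCost p (cApply s) s D) * _ at h2
  set L := blockApplyCost p (cApply s) s D
  set X := budget s (asNorm s u) ebar
  constructor
  · have h3 : 2 * L ≤ iterCost kappa D L := by
      have : 0 ≤ kappa * (D + 1) := by positivity
      unfold iterCost resCost raylCost
      linarith
    have h4 := mul_le_mul_of_nonneg_right h3 (zero_le_one.trans hX)
    linarith
  · have hflops : (normalize (x - (res p SA SC T x η).val)).flops =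
        3 * (x - (res p SA SC T x η).val).support.card + 2 := rfl
    rw [hflops, iterCost]
    push_cast
    linarith

/-- An iteration block ends, with an approximation that is by the factor `c1` more accurate than
the one it starts with, and with a support and a number of operations that are bounded in units of
the budget. -/
theorem exists_coarsen_of_iterate (hM : 2 * invNorm A C u p.lam ≤ p.M)
    (hδ : p.eps0 ≤ p.deltaBar ‖C‖) {sstar : ℝ} {cApply : ℝ → ℝ}
    (hSA : SA.IsSparse sstar cApply) (hSC : SC.IsSparse sstar cApply) {ebar : ℝ}
    (he0 : 0 < ebar) (he : ebar ≤ p.eps0) {v : I →₀ ℝ} (hv : IsApprox u ebar v) {n0 f0 : ℕ}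
    (hrun : minieig p SA SC T x0 eps n0 = ⟨.iterate ebar v ((1 - p.xi) * ebar) 0, f0⟩) :
    ∃ (n : ℕ) (w : I →₀ ℝ) (f : ℕ), minieig p SA SC T x0 eps n = ⟨.coarsen ebar w, f⟩ ∧
      IsApprox u (p.c1 * ebar) w ∧
      ∀ s D : ℝ, 0 < s → s < sstar → MemAs s u → 0 ≤ D →
        (v.support.card : ℝ) ≤ D * budget s (asNorm s u) ebar →
        (w.support.card : ℝ) ≤
          iterConst p kappa (cApply s) s D (maxIter p + 1) * budget s (asNorm s u) ebar ∧
        (f : ℝ) ≤ f0 +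
          iterConst p kappa (cApply s) s D (maxIter p + 1) * budget s (asNorm s u) ebar := by
  have hκ := T.kappa_nonneg
  have hβ := hp.beta_pos
  -- for every `j`, the block has ended or reaches its iteration `j`
  suffices key : ∀ j : ℕ,
      (∃ (n : ℕ) (w : I →₀ ℝ) (f : ℕ), minieig p SA SC T x0 eps n = ⟨.coarsen ebar w, f⟩ ∧
        IsApprox u (p.c1 * ebar) w ∧
        ∀ s D : ℝ, 0 < s → s < sstar → MemAs s u → 0 ≤ D →
          (v.support.card : ℝ) ≤ D * budget s (asNorm s u) ebar →
          (w.support.card : ℝ) ≤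
            iterConst p kappa (cApply s) s D (maxIter p + 1) * budget s (asNorm s u) ebar ∧
          (f : ℝ) ≤ f0 +
            iterConst p kappa (cApply s) s D (maxIter p + 1) * budget s (asNorm s u) ebar) ∨
      (∃ (n : ℕ) (w : I →₀ ℝ) (f : ℕ),
        minieig p SA SC T x0 eps n = ⟨.iterate ebar w ((1 - p.xi) * ebar / 2 ^ j) j, f⟩ ∧
        j ≤ maxIter p ∧
        (∃ e, IsApprox u e w ∧ e ≤ ebar ∧ p.beta * e ≤ ebar * p.xi ^ j) ∧
        ∀ s D : ℝ, 0 < s → s < sstar → MemAs s u → 0 ≤ D →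
          (v.support.card : ℝ) ≤ D * budget s (asNorm s u) ebar →
          (w.support.card : ℝ) ≤
            iterConst p kappa (cApply s) s D j * budget s (asNorm s u) ebar ∧
          (f : ℝ) ≤ f0 +
            iterConst p kappa (cApply s) s D j * budget s (asNorm s u) ebar) by
    rcases key (maxIter p + 1) with h1 | ⟨_, _, _, _, h2, _⟩
    · exact h1
    · omega
  intro j
  induction j with
  | zero =>
    refine Or.inr ⟨n0, v, f0, by simpa using hrun, Nat.zero_le _, ⟨ebar, hv, le_rfl, ?_⟩, ?_⟩
    · rw [pow_zero, mul_one]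
      exact mul_le_of_le_one_left he0.le hp.beta_lt.le
    · intro s D _ _ _ hD hcard
      refine ⟨hcard, le_add_of_nonneg_right (mul_nonneg hD ?_)⟩
      exact Real.rpow_nonneg (div_nonneg (asNorm_nonneg _ _) he0.le) _
  | succ j ih =>
    rcases ih with hdone | ⟨n, w, f, hn, hj, ⟨e, hw, hee, hej⟩, hcost⟩
    · exact Or.inl hdone
    set η := (1 - p.xi) * ebar / 2 ^ j with hη
    have hηle : blockTol p * ebar ≤ η := blockTol_mul_le hp he0 hj
    have hη0 : 0 < η := (mul_pos (blockTol_pos hp) he0).trans_le hηle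
    obtain ⟨hη1, hrec1, hrec2⟩ := hp.error_recursion he0 he j hee hej
    have hed : e ≤ p.d := hee.trans (he.trans hp.eps0_le)
    have hacc := res_accurate h hp SA SC T (hw.mono hed) hη0
    have hnew := isApprox_normalize_sub h hp hw hed hη1 hacc
    have hmono : ∀ s D : ℝ, 0 ≤ D → iterConst p kappa (cApply s) s D (j + 1) ≤
        iterConst p kappa (cApply s) s D (maxIter p + 1) := fun s D hD =>
      iterConst_monotone hp hκ hD (Nat.succ_le_succ hj)
    have hbudget : ∀ s : ℝ, 0 ≤ budget s (asNorm s u) ebar := fun s =>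
      Real.rpow_nonneg (div_nonneg (asNorm_nonneg _ _) he0.le) _
    have hcost' : ∀ s D : ℝ, 0 < s → s < sstar → MemAs s u → 0 ≤ D →
        (v.support.card : ℝ) ≤ D * budget s (asNorm s u) ebar →
        ((normalize (w - (res p SA SC T w η).val)).val.support.card : ℝ) ≤
          iterConst p kappa (cApply s) s D (j + 1) * budget s (asNorm s u) ebar ∧
        ((f + ((res p SA SC T w η).flops + 2 * (res p SA SC T w η).val.support.card + 5 +
          w.support.card + (res p SA SC T w η).val.support.card +
          (normalize (w - (res p SA SC T w η).val)).flops + 3) : ℕ) : ℝ) ≤ f0 +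
          iterConst p kappa (cApply s) s D (j + 1) * budget s (asNorm s u) ebar := by
      intro s D hs0 hs hmem hD hcard
      obtain ⟨h1, h2⟩ := hcost s D hs0 hs hmem hD hcard
      obtain ⟨h3, h4⟩ := iterate_cost hp (T := T) h hSA hSC he0 he hηle (hw.mono hee) hs0 hs hmem
        (iterConst_nonneg hp hκ hD j) h1
      refine ⟨h3, ?_⟩
      rw [Nat.cast_add, iterConst, add_mul]
      linarith
    by_cases hsmall : η + ‖toL2 (res p SA SC T w η).val‖ ≤ p.alpha * p.c1 * ebar / p.M
    · left
      have hrun' := minieig_succ hn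
      rw [step_iterate_of_residual_le hsmall] at hrun'
      refine ⟨n + 1, w, _, hrun', ?_, ?_⟩
      · exact isApprox_of_residual_le h hp hw
          (le_min hed (hee.trans (he.trans hδ))) hM hacc hsmall
      · intro s D hs0 hs hmem hD hcard
        obtain ⟨h1, -⟩ := hcost s D hs0 hs hmem hD hcard
        obtain ⟨-, h4⟩ := hcost' s D hs0 hs hmem hD hcard
        have h5 := mul_le_mul_of_nonneg_right (hmono s D hD) (hbudget s)
        have h6 := mul_le_mul_of_nonneg_right
          (iterConst_monotone hp hκ hD (c := cApply s) (s := s)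
            (show j ≤ maxIter p + 1 by omega)) (hbudget s)
        refine ⟨h1.trans h6, le_trans ?_ (h4.trans (by linarith))⟩
        exact Nat.cast_le.mpr (by dsimp only; omega)
    by_cases hlog : Real.log (p.c1 * p.beta) / Real.log p.xi ≤ (j + 1 : ℕ)
    · left
      have hrun' := minieig_succ hn
      rw [step_iterate_of_log_le hsmall hlog] at hrun'
      refine ⟨n + 1, _, _, hrun', hnew.mono ?_, ?_⟩
      · have h1 := hrec2.trans
          (mul_le_mul_of_nonneg_left (hp.xi_pow_le_of_log_le hlog) he0.le)
        exact le_of_mul_le_mul_left (h1.trans_eq (by ring)) hβ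
      · intro s D hs0 hs hmem hD hcard
        obtain ⟨h3, h4⟩ := hcost' s D hs0 hs hmem hD hcard
        have h5 := mul_le_mul_of_nonneg_right (hmono s D hD) (hbudget s)
        exact ⟨h3.trans h5, h4.trans (by linarith)⟩
    · right
      have hrun' := minieig_succ hn
      rw [step_iterate_of_lt_log hsmall hlog] at hrun'
      have hhalf : η / 2 = (1 - p.xi) * ebar / 2 ^ (j + 1) := by
        rw [hη, pow_succ, div_div]
      rw [hhalf] at hrun'
      refine ⟨n + 1, _, _, hrun', ?_, ⟨_, hnew, hrec1, hrec2⟩, hcost'⟩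
      exact (Nat.lt_ceil.mpr (not_le.mp hlog)).le

end Block

/-! ### Coarsening -/

/-- The support constant that coarsening produces, whatever the number of entries before it. -/
def coarseConst (p : Params) (s : ℝ) : ℝ := (2 / p.c1) ^ (1 / s) + 1

/-- The constant in the cost of coarsening a vector with support constant `D`. -/
def coarseCost (p : Params) (κ s D : ℝ) : ℝ := κ * (D + 1) + 3 * coarseConst p s + 8

theorem one_le_coarseConst {p : Params} (hp : p.Valid) (s : ℝ) : 1 ≤ coarseConst p s := by
  have := hp.c1_pos
  unfold coarseConst
  exact le_add_of_nonneg_left (by positivity)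

section Coarsen

variable {p : Params} (hp : p.Valid) {kappa : ℝ} {I : Type v} {u : L2 I}
  (T : ApproxRoutine I p.omega kappa) (hu : ‖u‖ = 1)
include hp hu

/-- The thresholding tolerance exceeds the error of `x` by so much that a near-best approximation
of the eigenvector competes in the minimality property of the thresholded vector. -/
theorem card_support_approx_le {x : I →₀ ℝ} {ebar : ℝ} (he0 : 0 < ebar) (he1 : ebar ≤ 1)
    (hx : IsApprox u (p.c1 * ebar) x) {s : ℝ} (hs : 0 < s) (hmem : MemAs s u) :
    ((T.run x (3 * p.c1 * ebar / (Real.sqrt 2 * p.omega))).val.support.card : ℝ) ≤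
      coarseConst p s * budget s (asNorm s u) ebar := by
  have hc := hp.c1_pos
  have hω : 0 < p.omega := by linarith [hp.omega_ge]
  have hW : 1 ≤ asNorm s u := hu ▸ norm_le_asNorm s u
  have hce : 0 < p.c1 * ebar := by positivity
  obtain ⟨z, hz, hze⟩ := exists_card_le_norm_sub_le hs hmem hce (by linarith)
  set t := inner ℝ (toL2 x) u
  have ht : |t| ≤ 1 := abs_inner_le_one hu hx.1
  have h1 : ‖toL2 x - toL2 (t • z)‖ ≤ 2 * (p.c1 * ebar) := by
    have h2 : toL2 x - toL2 (t • z) = perp u (toL2 x) + t • (u - toL2 z) := by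
      rw [toL2_smul, perp_eq hu, smul_sub]; abel
    rw [h2]
    refine (norm_add_le _ _).trans ?_
    rw [norm_smul, Real.norm_eq_abs]
    nlinarith [hx.2, norm_nonneg (u - toL2 z)]
  have h3 : 2 * (p.c1 * ebar) ≤ p.omega * (3 * p.c1 * ebar / (Real.sqrt 2 * p.omega)) := by
    have h4 : Real.sqrt 2 ≤ 3 / 2 := by
      rw [Real.sqrt_le_left (by norm_num)]; norm_num
    have h5 : p.omega * (3 * p.c1 * ebar / (Real.sqrt 2 * p.omega)) =
        3 * (p.c1 * ebar) / Real.sqrt 2 := by field_simp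
    rw [h5, le_div_iff₀ (by positivity)]
    nlinarith
  have h6 : (T.run x (3 * p.c1 * ebar / (Real.sqrt 2 * p.omega))).val.support.card ≤
      z.support.card :=
    (T.sparse x _ (by positivity) _ (h1.trans h3)).trans (card_support_smul_le t z)
  have h7 : (2 * asNorm s u / (p.c1 * ebar)) ^ (1 / s) =
      (2 / p.c1) ^ (1 / s) * budget s (asNorm s u) ebar := by
    rw [budget, ← Real.mul_rpow (by positivity) (by positivity)]
    congr 1
    field_simp
  rw [h7] at hz
  have h8 := one_le_budget hs hW he0 he1
  rw [coarseConst, add_mul, one_mul]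
  exact (Nat.cast_le.mpr h6).trans (hz.trans (by linarith))

theorem coarsen_cost {x : I →₀ ℝ} {ebar : ℝ} (he0 : 0 < ebar) (he1 : ebar ≤ 1)
    (hx : IsApprox u (p.c1 * ebar) x) {s D : ℝ} (hs : 0 < s) (hmem : MemAs s u)
    (hcard : (x.support.card : ℝ) ≤ D * budget s (asNorm s u) ebar) :
    (((T.run x (3 * p.c1 * ebar / (Real.sqrt 2 * p.omega))).flops +
      (normalize (T.run x (3 * p.c1 * ebar / (Real.sqrt 2 * p.omega))).val).flops + 6 : ℕ) : ℝ) ≤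
      coarseCost p kappa s D * budget s (asNorm s u) ebar := by
  have h1 := card_support_approx_le hp T hu he0 he1 hx hs hmem
  have hc := hp.c1_pos
  have hω : 0 < p.omega := by linarith [hp.omega_ge]
  have hW : 1 ≤ asNorm s u := hu ▸ norm_le_asNorm s u
  have hX := one_le_budget hs hW he0 he1
  have hκ := T.kappa_nonneg
  have h2 := T.linear x (3 * p.c1 * ebar / (Real.sqrt 2 * p.omega)) (by positivity)
  have h3 : kappa * (x.support.card + 1) ≤ kappa * ((D + 1) * budget s (asNorm s u) ebar) := by
    gcongr
    linarith
  simp only [normalize, coarseCost]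
  push_cast
  linarith

end Coarsen

/-! ### The outer loop -/

/-- The support constant at the start of every block: that of the initial guess or that of
coarsening. -/
def startConst (p : Params) (C0 s : ℝ) : ℝ := max C0 (coarseConst p s)

/-- The support constant at the end of a block. -/
def endConst (p : Params) (κ C0 c s : ℝ) : ℝ :=
  iterConst p κ c s (startConst p C0 s) (maxIter p + 1)

/-- The constant in the cost of a block together with its coarsening. -/
def roundCost (p : Params) (κ C0 c s : ℝ) : ℝ :=
  endConst p κ C0 c s + coarseCost p κ s (endConst p κ C0 c s)

/-- The constant in the cost of all blocks before the current one.  The budget grows by the factor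
`2 ^ (1 / s)` from block to block, so that the costs form a geometric series. -/
def pastCost (p : Params) (κ C0 c s : ℝ) : ℝ := roundCost p κ C0 c s / (2 ^ (1 / s) - 1)

/-- The last block has accuracy at least `lastScale p * min 1 eps`. -/
def lastScale (p : Params) : ℝ := min p.eps0 (min 1 (p.gamma / (4 * p.Gamma * p.K)))

/-- The support constant of the result, in units of the budget for `min 1 eps`. -/
def finalConst (p : Params) (s : ℝ) : ℝ := coarseConst p s * (1 / lastScale p) ^ (1 / s)

/-- The constant in the cost of the whole run, in units of the budget for `min 1 eps`. -/
def totalCost (p : Params) (κ C0 c s : ℝ) : ℝ :=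
  (pastCost p κ C0 c s + roundCost p κ C0 c s) * (1 / lastScale p) ^ (1 / s) +
    raylCost κ (finalConst p s)
      (applyCost c s (2 + coarseConst p s ^ s) (finalConst p s) (raylTol p (1 / 2)))

section Constants

variable {p : Params} (hp : p.Valid) {κ C0 c s : ℝ} (hκ : 0 ≤ κ)
include hp

theorem lastScale_pos : 0 < lastScale p := by
  have h1 := hp.eps0_pos
  have h2 := hp.gamma_pos
  have h3 := hp.Gamma_pos
  have h4 := hp.K_pos
  unfold lastScale; positivity

theorem startConst_nonneg : 0 ≤ startConst p C0 s :=
  (zero_le_one.trans (one_le_coarseConst hp s)).trans (le_max_right _ _)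

include hκ

theorem roundCost_nonneg : 0 ≤ roundCost p κ C0 c s := by
  have h1 : 0 ≤ endConst p κ C0 c s := iterConst_nonneg hp hκ (startConst_nonneg hp) _
  have h2 := one_le_coarseConst hp s
  unfold roundCost coarseCost
  positivity

theorem pastCost_nonneg (hs : 0 < s) : 0 ≤ pastCost p κ C0 c s := by
  have h1 : (1 : ℝ) < 2 ^ (1 / s) := Real.one_lt_rpow (by norm_num) (by positivity)
  exact div_nonneg (roundCost_nonneg hp hκ) (by linarith)

omit hp hκ in
theorem pastCost_add_roundCost (hs : 0 < s) :
    pastCost p κ C0 c s + roundCost p κ C0 c s = pastCost p κ C0 c s * 2 ^ (1 / s) := by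
  have h1 : (1 : ℝ) < 2 ^ (1 / s) := Real.one_lt_rpow (by norm_num) (by positivity)
  have h2 : (2 : ℝ) ^ (1 / s) - 1 ≠ 0 := by linarith
  rw [pastCost]
  field_simp
  ring

end Constants

section Outer

variable {p : Params} (hp : p.Valid) {kappa : ℝ} {I : Type v} {A C : L2 I →L[ℝ] L2 I}
  {u : L2 I} {SA : ApplyScheme A} {SC : ApplyScheme C} {T : ApproxRoutine I p.omega kappa}
  {x0 : I →₀ ℝ} {eps : ℝ} (h : IsEigenProblem p A C u)
include hp h

/-- A block and the coarsening after it halve the error bound and, since coarsening resets the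
support constant, restore the invariant that the block started with. If the new bound is above
the target, the next block starts from there; otherwise the run halts, and the budget of the last
block is comparable to that for `min 1 eps`. -/
theorem halted_or_next_block (heps : 0 < eps) (hadm : IsAdmissible p A C u x0) {sstar : ℝ}
    {cApply : ℝ → ℝ} (hSA : SA.IsSparse sstar cApply) (hSC : SC.IsSparse sstar cApply) {C0 : ℝ}
    (k : ℕ) (hk : k = 0 ∨ p.target eps < p.eps0 / 2 ^ k)
    {n0 f0 : ℕ} {v : I →₀ ℝ}
    (hrun : minieig p SA SC T x0 eps n0 =
      ⟨.iterate (p.eps0 / 2 ^ k) v ((1 - p.xi) * (p.eps0 / 2 ^ k)) 0, f0⟩)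
    (hv : IsApprox u (p.eps0 / 2 ^ k) v)
    (hcost : ∀ s : ℝ, 0 < s → s < sstar → MemAs s u →
      (x0.support.card : ℝ) ≤ C0 * asNorm s u ^ (1 / s) →
      (v.support.card : ℝ) ≤ startConst p C0 s * budget s (asNorm s u) (p.eps0 / 2 ^ k) ∧
      (f0 : ℝ) ≤ pastCost p kappa C0 (cApply s) s * budget s (asNorm s u) (p.eps0 / 2 ^ k)) :
    (∃ (n : ℕ) (l : ℝ) (w : I →₀ ℝ) (f : ℕ),
      minieig p SA SC T x0 eps n = ⟨.halted l w, f⟩ ∧ IsApprox u eps w ∧ |p.lam - l| ≤ eps ∧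
      ∀ s : ℝ, 0 < s → s < sstar → MemAs s u →
        (x0.support.card : ℝ) ≤ C0 * asNorm s u ^ (1 / s) →
        (w.support.card : ℝ) ≤ finalConst p s * budget s (asNorm s u) (min 1 eps) ∧
        (f : ℝ) ≤ totalCost p kappa C0 (cApply s) s * budget s (asNorm s u) (min 1 eps) ∧
        asNorm s (toL2 w) ≤ (2 + coarseConst p s ^ s) * asNorm s u) ∨
    (∃ (n : ℕ) (w : I →₀ ℝ) (f : ℕ), p.target eps < p.eps0 / 2 ^ (k + 1) ∧
      minieig p SA SC T x0 eps n =
        ⟨.iterate (p.eps0 / 2 ^ (k + 1)) w ((1 - p.xi) * (p.eps0 / 2 ^ (k + 1))) 0, f⟩ ∧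
      IsApprox u (p.eps0 / 2 ^ (k + 1)) w ∧
      ∀ s : ℝ, 0 < s → s < sstar → MemAs s u →
        (x0.support.card : ℝ) ≤ C0 * asNorm s u ^ (1 / s) →
        (w.support.card : ℝ) ≤
          startConst p C0 s * budget s (asNorm s u) (p.eps0 / 2 ^ (k + 1)) ∧
        (f : ℝ) ≤
          pastCost p kappa C0 (cApply s) s * budget s (asNorm s u) (p.eps0 / 2 ^ (k + 1))) := by
  have hκ := T.kappa_nonneg
  have heps0 := hp.eps0_pos
  have hhalf : p.eps0 / 2 ^ (k + 1) = p.eps0 / 2 ^ k / 2 := by rw [pow_succ, div_div]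
  rw [hhalf]
  have he : p.eps0 / 2 ^ k ≤ p.eps0 :=
    div_le_self heps0.le (one_le_pow₀ (by norm_num))
  set ebar := p.eps0 / 2 ^ k with hebar
  have he0 : 0 < ebar := by positivity
  have he1 : ebar ≤ 1 := he.trans (hp.eps0_le_quarter.trans (by norm_num))
  obtain ⟨n, w, f, hn, hw, hblock⟩ := exists_coarsen_of_iterate hp h hadm.M_ge
    (hadm.eps0_le.trans (min_le_right _ _)) hSA hSC he0 he hv hrun
  have hz := isApprox_normalize_approx h hp T he0 he hw
  have hround : ∀ s : ℝ, 0 < s → s < sstar → MemAs s u →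
      (x0.support.card : ℝ) ≤ C0 * asNorm s u ^ (1 / s) →
      ((normalize (T.run w (3 * p.c1 * ebar / (Real.sqrt 2 * p.omega))).val).val.support.card : ℝ)
        ≤ coarseConst p s * budget s (asNorm s u) ebar ∧
      ((f + ((T.run w (3 * p.c1 * ebar / (Real.sqrt 2 * p.omega))).flops +
        (normalize (T.run w (3 * p.c1 * ebar / (Real.sqrt 2 * p.omega))).val).flops + 6) : ℕ) : ℝ)
        ≤ (pastCost p kappa C0 (cApply s) s + roundCost p kappa C0 (cApply s) s) *
          budget s (asNorm s u) ebar := by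
    intro s hs0 hs hmem hx0
    obtain ⟨h1, h2⟩ := hcost s hs0 hs hmem hx0
    obtain ⟨h3, h4⟩ := hblock s _ hs0 hs hmem (startConst_nonneg hp) h1
    constructor
    · exact (Nat.cast_le.mpr (card_support_normalize_le _)).trans
        (card_support_approx_le hp T h.norm_u he0 he1 hw hs0 hmem)
    · have h5 := coarsen_cost hp T h.norm_u he0 he1 hw hs0 hmem h3
      rw [Nat.cast_add, roundCost, endConst]
      linarith
  set z := (normalize (T.run w (3 * p.c1 * ebar / (Real.sqrt 2 * p.omega))).val).val with hzdef
  have hrun' := minieig_succ hn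
  by_cases hlast : ebar / 2 ≤ p.target eps
  · left
    rw [step_coarsen_of_le hlast] at hrun'
    dsimp only at hrun'
    rw [← hzdef] at hrun'
    have hzd : IsApprox u p.d z := hz.mono (by linarith [hp.eps0_le])
    refine ⟨n + 1, _, z, _, hrun', hz.mono (hlast.trans (min_le_left _ _)), ?_, ?_⟩
    · obtain ⟨-, -, hl⟩ := rayl_accurate h hp SA SC T hzd (half_pos heps)
      have h1 := h.rayleigh_sub_lam_le hp hzd.1 hzd.2
      have h2 := h.lam_le_rayleigh hzd.1
      -- one factor of the squared error is at most `eps`, the other at most `γ / (4 Γ K)`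
      have h3 : p.Gamma * p.K / p.gamma * ‖perp u (toL2 z)‖ ^ 2 ≤ eps / 4 := by
        have hγ := hp.gamma_pos
        have hΓ := hp.Gamma_pos
        have hK := hp.K_pos
        have e1 : ‖perp u (toL2 z)‖ ≤ eps := hz.2.trans (hlast.trans (min_le_left _ _))
        have e2 : ‖perp u (toL2 z)‖ ≤ p.gamma / (4 * p.Gamma * p.K) :=
          hz.2.trans (hlast.trans (min_le_right _ _))
        calc p.Gamma * p.K / p.gamma * ‖perp u (toL2 z)‖ ^ 2
            = p.Gamma * p.K / p.gamma * (‖perp u (toL2 z)‖ * ‖perp u (toL2 z)‖) := by ring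
          _ ≤ p.Gamma * p.K / p.gamma * (p.gamma / (4 * p.Gamma * p.K) * eps) := by gcongr
          _ = eps / 4 := by field_simp
      rw [abs_le] at hl ⊢
      constructor <;> linarith
    · intro s hs0 hs hmem hx0
      obtain ⟨h1, h2⟩ := hround s hs0 hs hmem hx0
      have hW : 1 ≤ asNorm s u := h.norm_u ▸ norm_le_asNorm s u
      have hm0 : 0 < min 1 eps := lt_min one_pos heps
      have hC1 := one_le_coarseConst hp s
      have hscale : lastScale p * min 1 eps ≤ ebar := by
        rcases hk with rfl | hk
        · calc lastScale p * min 1 eps ≤ p.eps0 * 1 := by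
                gcongr
                · exact min_le_left _ _
                · exact min_le_left _ _
            _ = ebar := by rw [hebar]; simp
        · refine le_trans (le_min ?_ ?_) hk.le
          · calc lastScale p * min 1 eps ≤ 1 * eps := by
                  gcongr
                  · exact (min_le_right _ _).trans (min_le_left _ _)
                  · exact min_le_right _ _
              _ = eps := one_mul eps
          · calc lastScale p * min 1 eps ≤ p.gamma / (4 * p.Gamma * p.K) * 1 := by
                  have := lastScale_pos hp
                  gcongr
                  · exact this.le.trans ((min_le_right _ _).trans (min_le_right _ _))
                  · exact (min_le_right _ _).trans (min_le_right _ _)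
                  · exact min_le_left _ _
              _ = _ := mul_one _
      have hb := budget_le_mul hs0 (zero_le_one.trans hW) (lastScale_pos hp) hm0 hscale
      have hcard : (z.support.card : ℝ) ≤ finalConst p s * budget s (asNorm s u) (min 1 eps) := by
        refine h1.trans ?_
        rw [finalConst, mul_assoc]
        gcongr
      have hctl := (hz.mono (half_le_self he0.le)).isControlled h.norm_u hs0 hmem he0 he1
        (zero_le_one.trans hC1) h1
      have hctl' : IsControlled s (asNorm s u) (min 1 eps) (2 + coarseConst p s ^ s)
          (finalConst p s) z :=
        { s_pos := hs0
          one_le_W := hW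
          eps_pos := hm0
          eps_le := min_le_left _ _
          H_nonneg := hctl.H_nonneg
          D_nonneg := by
            have := lastScale_pos hp
            unfold finalConst; positivity
          norm_le := hctl.norm_le
          card_le := hcard }
      refine ⟨hcard, ?_, hctl.norm_le⟩
      have h3 := rayl_cost hp T hSA hSC h.norm_A_pos h.norm_C_pos (τ := 1 / 2) (η := eps / 2) hs
        hctl' (raylTol_pos hp (by norm_num)) le_rfl (by norm_num)
        (by linarith [min_le_right 1 eps])
      have h4 : (pastCost p kappa C0 (cApply s) s + roundCost p kappa C0 (cApply s) s) *
          budget s (asNorm s u) ebar ≤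
          (pastCost p kappa C0 (cApply s) s + roundCost p kappa C0 (cApply s) s) *
            ((1 / lastScale p) ^ (1 / s) * budget s (asNorm s u) (min 1 eps)) :=
        mul_le_mul_of_nonneg_left hb
          (add_nonneg (pastCost_nonneg hp hκ hs0) (roundCost_nonneg hp hκ))
      rw [totalCost, add_mul, mul_assoc _ _ (budget _ _ _), ← add_assoc, Nat.cast_add]
      exact add_le_add (h2.trans h4) h3
  · right
    rw [step_coarsen_of_lt hlast] at hrun'
    dsimp only at hrun'
    rw [← hzdef] at hrun'
    refine ⟨n + 1, z, _, not_le.mp hlast, hrun', hz, ?_⟩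
    intro s hs0 hs hmem hx0
    obtain ⟨h1, h2⟩ := hround s hs0 hs hmem hx0
    have hW : 1 ≤ asNorm s u := h.norm_u ▸ norm_le_asNorm s u
    have hX := one_le_budget hs0 hW he0 he1
    have hX' : budget s (asNorm s u) ebar ≤ budget s (asNorm s u) (ebar / 2) := by
      have := budget_le_mul (σ := 1) hs0 (zero_le_one.trans hW) one_pos (half_pos he0)
        (show 1 * (ebar / 2) ≤ ebar by linarith)
      simpa using this
    constructor
    · refine h1.trans (mul_le_mul (le_max_right _ _) hX' (zero_le_one.trans hX) ?_)
      exact startConst_nonneg hp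
    · rw [pastCost_add_roundCost hs0] at h2
      rwa [budget_half (zero_le_one.trans hW) he0, ← mul_assoc]

theorem exists_halted (heps : 0 < eps) (hadm : IsAdmissible p A C u x0) {sstar : ℝ}
    {cApply : ℝ → ℝ} (hSA : SA.IsSparse sstar cApply) (hSC : SC.IsSparse sstar cApply) (C0 : ℝ) :
    ∃ (n : ℕ) (l : ℝ) (w : I →₀ ℝ) (f : ℕ),
      minieig p SA SC T x0 eps n = ⟨.halted l w, f⟩ ∧ IsApprox u eps w ∧ |p.lam - l| ≤ eps ∧
      ∀ s : ℝ, 0 < s → s < sstar → MemAs s u →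
        (x0.support.card : ℝ) ≤ C0 * asNorm s u ^ (1 / s) →
        (w.support.card : ℝ) ≤ finalConst p s * budget s (asNorm s u) (min 1 eps) ∧
        (f : ℝ) ≤ totalCost p kappa C0 (cApply s) s * budget s (asNorm s u) (min 1 eps) ∧
        asNorm s (toL2 w) ≤ (2 + coarseConst p s ^ s) * asNorm s u := by
  by_contra hnot
  have reach : ∀ k : ℕ, ∃ (n : ℕ) (v : I →₀ ℝ) (f : ℕ),
      (k = 0 ∨ p.target eps < p.eps0 / 2 ^ k) ∧
      minieig p SA SC T x0 eps n =
        ⟨.iterate (p.eps0 / 2 ^ k) v ((1 - p.xi) * (p.eps0 / 2 ^ k)) 0, f⟩ ∧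
      IsApprox u (p.eps0 / 2 ^ k) v ∧
      ∀ s : ℝ, 0 < s → s < sstar → MemAs s u →
        (x0.support.card : ℝ) ≤ C0 * asNorm s u ^ (1 / s) →
        (v.support.card : ℝ) ≤ startConst p C0 s * budget s (asNorm s u) (p.eps0 / 2 ^ k) ∧
        (f : ℝ) ≤
          pastCost p kappa C0 (cApply s) s * budget s (asNorm s u) (p.eps0 / 2 ^ k) := by
    intro k
    induction k with
    | zero =>
      refine ⟨0, x0, 0, Or.inl rfl, by simp [minieig], ?_, ?_⟩
      · refine ⟨hadm.norm_x0, ?_⟩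
        have h1 := hadm.init
        rwa [perp_sub, perp_self h.norm_u, sub_zero, ← div_one p.eps0, ← pow_zero 2] at h1
      · intro s hs0 _ _ hx0
        have hW : 1 ≤ asNorm s u := h.norm_u ▸ norm_le_asNorm s u
        have he1 : p.eps0 / 2 ^ 0 ≤ 1 := by
          have := hp.eps0_le_quarter
          rw [pow_zero, div_one]; linarith
        have he0 : 0 < p.eps0 / 2 ^ 0 := div_pos hp.eps0_pos (by positivity)
        have hX := one_le_budget hs0 hW he0 he1
        constructor
        · have h1 : asNorm s u ^ (1 / s) ≤ budget s (asNorm s u) (p.eps0 / 2 ^ 0) := by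
            refine Real.rpow_le_rpow (by linarith) ?_ (by positivity)
            exact le_div_self (by linarith) he0 he1
          refine hx0.trans (mul_le_mul (le_max_left _ _) h1 (by positivity) ?_)
          exact startConst_nonneg hp
        · rw [Nat.cast_zero]
          exact mul_nonneg (pastCost_nonneg hp T.kappa_nonneg hs0) (zero_le_one.trans hX)
    | succ k ih =>
      obtain ⟨n, v, f, hk, hrun, hv, hcost⟩ := ih
      rcases halted_or_next_block hp h heps hadm hSA hSC k hk hrun hv hcost with
        hdone | ⟨n', w, f', hk', hnext⟩
      · exact absurd hdone hnot
      · exact ⟨n', w, f', Or.inr hk', hnext⟩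
  have htarget := hp.target_pos heps
  obtain ⟨k, hk⟩ := pow_unbounded_of_one_lt (p.eps0 / p.target eps) (one_lt_two (α := ℝ))
  obtain ⟨_, _, _, hk', _⟩ := reach (k + 1)
  rcases hk' with hk' | hk'
  · omega
  · rw [lt_div_iff₀ (by positivity), pow_succ] at hk'
    rw [div_lt_iff₀ htarget] at hk
    have : 0 < 2 ^ k * p.target eps := by positivity
    linarith

end Outer

end

end AdaptiveEigen


theorem mainTheorem1 (p : AdaptiveEigen.Params) (sstar : ℝ) (hsstar : 0 < sstar)
    (cApply : ℝ → ℝ) (kappa C0 : ℝ) :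
    ∃ Cst : ℝ → ℝ,
      ∀ (I : Type*) (A C : AdaptiveEigen.L2 I →L[ℝ] AdaptiveEigen.L2 I) (u : AdaptiveEigen.L2 I)
        (SA : AdaptiveEigen.ApplyScheme A) (SC : AdaptiveEigen.ApplyScheme C)
        (T : AdaptiveEigen.ApproxRoutine I p.omega kappa) (x0 : I →₀ ℝ),
        AdaptiveEigen.IsEigenProblem p A C u →
        SA.IsSparse sstar cApply →
        SC.IsSparse sstar cApply →
        AdaptiveEigen.IsAdmissible p A C u x0 →
        ∀ eps : ℝ, 0 < eps →
          ∃ (n : ℕ) (lamEps : ℝ) (uEps : I →₀ ℝ) (flops : ℕ),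
            AdaptiveEigen.minieig p SA SC T x0 eps n = ⟨.halted lamEps uEps, flops⟩ ∧
            ‖AdaptiveEigen.toL2 uEps‖ = 1 ∧
            ‖AdaptiveEigen.perp u (u - AdaptiveEigen.toL2 uEps)‖ ≤ eps ∧
            |p.lam - lamEps| ≤ eps ∧
            ∀ s : ℝ, 0 < s → s < sstar → AdaptiveEigen.MemAs s u →
              (x0.support.card : ℝ) ≤ C0 * AdaptiveEigen.asNorm s u ^ (1 / s) →
              (uEps.support.card : ℝ) ≤
                Cst s * (max 1 (eps ^ (-(1 / s))) * AdaptiveEigen.asNorm s u ^ (1 / s)) ∧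
              (flops : ℝ) ≤
                Cst s * (max 1 (eps ^ (-(1 / s))) * AdaptiveEigen.asNorm s u ^ (1 / s)) ∧
              AdaptiveEigen.asNorm s (AdaptiveEigen.toL2 uEps) ≤
                Cst s * AdaptiveEigen.asNorm s u := by
  refine ⟨fun s => max (AdaptiveEigen.finalConst p s)
    (max (AdaptiveEigen.totalCost p kappa C0 (cApply s) s)
      (2 + AdaptiveEigen.coarseConst p s ^ s)), ?_⟩
  intro I A C u SA SC T x0 h hSA hSC hadm eps heps
  obtain ⟨n, l, w, f, hn, hw, hl, hcost⟩ :=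
    AdaptiveEigen.exists_halted (T := T) (h.valid hadm) h heps hadm hSA hSC C0
  refine ⟨n, l, w, f, hn, hw.1, ?_, hl, ?_⟩
  · rw [AdaptiveEigen.perp_sub, AdaptiveEigen.perp_self h.norm_u, zero_sub, norm_neg]
    exact hw.2
  · intro s hs0 hs hmem hx0
    obtain ⟨h1, h2, h3⟩ := hcost s hs0 hs hmem hx0
    have hW := AdaptiveEigen.asNorm_nonneg s u
    rw [AdaptiveEigen.budget_min_one hs0 hW heps] at h1 h2
    have hX : 0 ≤ max 1 (eps ^ (-(1 / s))) * AdaptiveEigen.asNorm s u ^ (1 / s) := by positivity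
    refine ⟨h1.trans ?_, h2.trans ?_, h3.trans ?_⟩
    · exact mul_le_mul_of_nonneg_right (le_max_left _ _) hX
    · exact mul_le_mul_of_nonneg_right ((le_max_left _ _).trans (le_max_right _ _)) hX
    · exact mul_le_mul_of_nonneg_right ((le_max_right _ _).trans (le_max_right _ _)) hW
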